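/- **Conventions.** All actions on simplicial trees are by automorphisms and without inversion (no group element flips an edge). For a group $G$ acting on a simplicial tree $S$, $E(S)$ is the set of oriented edges and $G(e)$ is the pointwise stabilizer of $e\in E(S)$. A subgroup of $G$ is *elliptic* in $S$ if it fixes a point of $S$; the action is *non-trivial* if $G$ itself is not elliptic. A pair $(G,\{H_1,\dots,H_p\})$ is a group with a finite (possibly empty) family of subgroups; it is *finitely generated* if $G$ is generated by $F\cup H_1\cup\dots\cup H_p$ for some finite set $F\subset G$. An action, or splitting, of the pair is an action of $G$ on a simplicial tree in which every $H_i$ is elliptic. It is a splitting *over* a subgroup $C\le G$ if some edge of the tree has stabilizer $C$ and every edge is, up to orientation, a translate of that edge. An *epimorphism* $(\phi,f):G\curvearrowright S\to G'\curvearrowright S'$ consists of an onto homomorphism $\phi:G\to G'$ and a $\phi$-equivariant continuous map $f:S\to S'$ sending every edge to a (possibly degenerate) edge path. **Theorem (Extended Scott's Lemma, relative version).** Let $(G_k,\{H_1^k,\dots,H_p^k\})\curvearrowright S_k$, $k\ge 0$, be a sequence of non-trivial actions of finitely generated pairs on simplicial trees, and let $(\phi_k,f_k):G_k\curvearrowright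 S_k\to G_{k+1}\curvearrowright S_{k+1}$ be epimorphisms with $\phi_k(H_i^k)=H_i^{k+1}$ for all $k,i$. Let $G=\varinjlim G_k$ be the inductive limit, $\Phi_k:G_k\to G$ the natural maps, and $H_i=\Phi_k(H_i^k)\le G$ (which does not depend on $k$). Assume that for every $k$: 1. for all $e\in E(S_k)$ and $e'\in E(S_{k+1})$, if $e'\subset f_k(e)$ then $G_{k+1}(e')=\phi_k(G_k(e))$; 2. for all $e\in E(S_k)$ and all $i$, $\Phi_k(H_i^k)\not\subset\Phi_k(G_k(e))$. Then the pair $(G,\{H_1,\dots,H_p\})$ has a non-trivial splitting over $\Phi_k(G_k(e))$ for some $k$ and some $e\in E(S_k)$. Moreover, this splitting can be chosen such that for every $k$ and every subgroup $K\le G_k$ that is elliptic in $S_k$, the image $\Phi_k(K)\le G$ is elliptic in it. -/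

import Mathlib

universe u v

/-- An action, without inversion, of a group `G` on a simplicial tree with vertex set `V`. -/
structure TreeAction (G : Type u) [Group G] (V : Type v) where
  /-- The tree. -/
  tree : SimpleGraph V
  isTree : tree.IsTree
  /-- The action of `G` by automorphisms of the tree. -/
  act : G →* (tree ≃g tree)
  /-- No element of `G` flips an edge. -/
  noInversion : ∀ (g : G) (a b : V), tree.Adj a b → ¬ (act g a = b ∧ act g b = a)

namespace TreeAction

variable {G : Type u} [Group G] {V : Type v} (S : TreeAction G V)

/-- The stabilizer `G(e)` of an oriented edge `e` of the tree: the elements fixing `e` pointwise. -/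
def edgeStabilizer (e : S.tree.Dart) : Subgroup G where
  carrier := {g | S.act g e.fst = e.fst ∧ S.act g e.snd = e.snd}
  one_mem' := by simp
  mul_mem' := by
    rintro g h ⟨hg, hg'⟩ ⟨hh, hh'⟩
    simp only [Set.mem_ofPred_eq, map_mul, RelIso.mul_apply]
    exact ⟨by rw [hh, hg], by rw [hh', hg']⟩
  inv_mem' := by
    rintro g ⟨hg, hg'⟩
    have key : ∀ a : V, S.act g a = a → S.act g⁻¹ a = a := by
      intro a ha
      conv_lhs => rw [← ha]
      rw [map_inv, RelIso.inv_apply_self]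
    exact ⟨key _ hg, key _ hg'⟩

/-- A subgroup `H` of `G` is elliptic if it fixes a point of the tree. As there are no inversions,
an element fixing an interior point of an edge fixes both endpoints, so that fixing a point of
the geometric realization is the same as fixing a vertex. -/
def IsElliptic (H : Subgroup G) : Prop :=
  ∃ a : V, ∀ g ∈ H, S.act g a = a

/-- The action is non-trivial if `G` fixes no point of the tree. -/
def IsNontrivial : Prop :=
  ¬ S.IsElliptic ⊤

/-- The action is a splitting over the subgroup `C`: there is an edge with stabilizer `C`, and
every edge is a translate of it (up to orientation). -/
def IsSplittingOver (C : Subgroup G) : Prop :=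
  ∃ e : S.tree.Dart, S.edgeStabilizer e = C ∧
    ∀ e' : S.tree.Dart, ∃ g : G,
      (S.act g e.fst = e'.fst ∧ S.act g e.snd = e'.snd) ∨
      (S.act g e.fst = e'.snd ∧ S.act g e.snd = e'.fst)

end TreeAction

/-- An epimorphism `(φ, f)` from an action `G ↷ S` to an action `G' ↷ S'`: an onto morphism
`φ : G → G'` and a `φ`-equivariant map `f : S → S'` sending every edge to an edge path, possibly
degenerate and possibly with backtracking. A walk in a simple graph is determined by
the list of its vertices, its `support`. -/
structure TreeEpi {G : Type u} [Group G] {V : Type v} (S : TreeAction G V)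
    {G' : Type u} [Group G'] {V' : Type v} (S' : TreeAction G' V') where
  /-- The morphism `φ`. -/
  hom : G →* G'
  hom_surjective : Function.Surjective hom
  /-- The map `f` on vertices. -/
  vert : V → V'
  /-- The edge path that is the image of an oriented edge under `f`. -/
  path : ∀ e : S.tree.Dart, S'.tree.Walk (vert e.fst) (vert e.snd)
  /-- The image of an edge does not depend on its orientation. -/
  path_symm : ∀ e : S.tree.Dart, (path e.symm).support = (path e).support.reverse
  vert_equivariant : ∀ (g : G) (a : V), vert (S.act g a) = S'.act (hom g) (vert a)
  path_equivariant : ∀ (g : G) (e e' : S.tree.Dart),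
    S.act g e.fst = e'.fst → S.act g e.snd = e'.snd →
      (path e').support = (path e).support.map (S'.act (hom g))

/-- The oriented edge `e'` of `S'` is contained in the image `f(e)`. -/
def TreeEpi.InImage {G : Type u} [Group G] {V : Type v} {S : TreeAction G V}
    {G' : Type u} [Group G'] {V' : Type v} {S' : TreeAction G' V'} (f : TreeEpi S S')
    (e' : S'.tree.Dart) (e : S.tree.Dart) : Prop :=
  e'.edge ∈ (f.path e).edges

/-- The pair `(G, {H 0, …, H (p-1)})` is finitely generated. -/
def IsFGPair {G : Type u} [Group G] {p : ℕ} (H : Fin p → Subgroup G) : Prop :=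
  ∃ F : Set G, F.Finite ∧ Subgroup.closure (F ∪ ⋃ i, (H i : Set G)) = ⊤

section SequentialLimit

variable {G : ℕ → Type u} [∀ k, Group (G k)]

/-- The composition `G k → G (k+1) → ⋯ → G l`. -/
def transition (φ : ∀ k, G k →* G (k + 1)) (k l : ℕ) (h : k ≤ l) : G k →* G l :=
  Nat.leRec (motive := fun l _ => G k →* G l) (MonoidHom.id (G k))
    (fun l _ ψ => (φ l).comp ψ) h

theorem transition_self (φ : ∀ k, G k →* G (k + 1)) (k : ℕ) :
    transition φ k k le_rfl = MonoidHom.id (G k) := by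
  simp [transition]

theorem transition_succ (φ : ∀ k, G k →* G (k + 1)) (k l : ℕ) (h : k ≤ l) :
    transition φ k (l + 1) (Nat.le_succ_of_le h) = (φ l).comp (transition φ k l h) := by
  simp only [transition]
  rw [Nat.leRec_succ]

instance transition_directedSystem (φ : ∀ k, G k →* G (k + 1)) :
    DirectedSystem G (fun i j h => transition φ i j h) where
  map_self i x := by
    rw [transition_self]
    rfl
  map_map k j i hij hjk x := by
    induction k, hjk using Nat.le_induction with
    | base => rw [transition_self]; rfl
    | succ n hn ih =>
      rw [transition_succ φ j n hn, transition_succ φ i n (hij.trans hn)]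
      simp only [MonoidHom.comp_apply]
      rw [ih]

/-- The inductive limit of the sequence `G 0 → G 1 → G 2 → ⋯`. -/
abbrev SeqLimit (φ : ∀ k, G k →* G (k + 1)) : Type u :=
  DirectLimit G (transition φ)

/-- The natural map `G k → lim G`. -/
def toSeqLimit (φ : ∀ k, G k →* G (k + 1)) (k : ℕ) : G k →* SeqLimit φ where
  toFun x := ⟦⟨k, x⟩⟧
  map_one' := (DirectLimit.one_def k).symm
  map_mul' x y := (DirectLimit.mul_def k x y).symm

end SequentialLimit

/-!
The proof plays the trees `S k` against graphs of least complexity. All trees are regarded as trees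
with an action of the single group `Γ = G 0`, which maps onto each `G k`; let `K k` be the kernel of
`Γ → G k` and `L` that of `Γ → lim G k`, so that `L` is the union of the `K k`.

*Graphs over a tree.* A graph over a `Γ`-tree `S` is a `Γ`-graph `X` with a simplicial map to `S`
such that an edge that is not collapsed has the same stabilizer as its image. A finitely generated
pair acting with elliptic peripheral subgroups has a connected graph over its tree with finitely
many orbits of cells (`TreeAction.exists_cofinite_over`). If the graph `X / Γ` has first Betti
number `b`, and `n` orbits of vertices are not trivial (a vertex is trivial if its stabilizer is
that of each incident edge), then the complexity of `X` is `2 b + n - 2`, which is at least `-2`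
(`GGraph.neg_two_le_complexity`).

*Folding.* If the map from `X` to `S` is not injective, then an edge can be collapsed or two edges
can be folded. Since edge stabilizers equal those of the images, two edges that are folded have the
same stabilizer and lie in distinct orbits, so that the move removes one orbit of edges and
identifies two vertices `w₁` and `w₂`. If these are translates of each other or if neither is
trivial, then the complexity drops (`GGraph.exists_merge_of_not_isTriv`). Otherwise one of them is
trivial; the move does not increase the complexity and is an equivariant homotopy equivalence that
does not create elliptic subgroups (`GGraph.exists_merge_of_isTriv`). Hence a graph of least
complexity over `S` ends up, by moves of the second kind, as a subtree of `S`, so that it is a tree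
in which each subgroup elliptic in `S` is elliptic (`GGraph.IsMinimal.acyclic_and_elliptic`).

*Passing to the limit.* Among all graphs over all the trees `S k`, let `X`, over `S m`, have the
least complexity. For `n ≥ m`, the condition on edge stabilizers makes `X / K n`, once it is
subdivided along the map `S m → S n`, a graph over `S n`. Neither the quotient nor the subdivision
increases the complexity (`GGraph.complexity_quot_le`, `GGraph.PathOver.complexity_subdiv_le`), so
that `X / K n` is a tree by minimality (`TreeSequence.exists_quot_acyclic`). Therefore `X / L` is a
tree as well (`GGraph.acyclic_quot_iUnion`), and `lim G k` acts on it with edge stabilizers of the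
required form. As no `H i` fixes an edge of `X / L`, a global fixed point would be the only fixed
point of each `H i`; by finite generation it would give a fixed point of `G n` in `S n` for some `n`
(`TreeSequence.not_elliptic_top`). Finally, collapsing orbits of edges or passing to a subtree
leaves one orbit of edges (`GGraph.exists_transitive`).

Connectedness and acyclicity of graphs are expressed by cohomology with coefficients in `ℤ/2`:
locally constant functions are constant, and each cochain on the edges is a coboundary. In this form
both properties pass to quotients and to limits by a direct manipulation of functions on the
vertices.
-/

/-! ### Trees -/

namespace SimpleGraph

variable {V : Type*} {T : SimpleGraph V}

/-- The edge `{c, d}` separates `a` from `b`: every walk from `a` to `b` crosses it. In a tree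
these are the edges of the geodesic from `a` to `b`. -/
def EdgeSeparates (T : SimpleGraph V) (c d a b : V) : Prop :=
  ∀ w : T.Walk a b, s(c, d) ∈ w.edges

theorem IsAcyclic.edges_subset_of_isPath (hT : T.IsAcyclic) {a b : V} {p : T.Walk a b}
    (hp : p.IsPath) (w : T.Walk a b) : p.edges ⊆ w.edges := by
  classical
  have h : p = w.bypass :=
    Subtype.mk.inj <| (hT.subsingleton_path a b).elim ⟨p, hp⟩ ⟨_, w.bypass_isPath⟩
  rw [h]
  exact w.edges_bypass_subset_edges

theorem IsAcyclic.edgeSeparates_of_mem_edges (hT : T.IsAcyclic) {a b c d : V} {p : T.Walk a b}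
    (hp : p.IsPath) (h : s(c, d) ∈ p.edges) : T.EdgeSeparates c d a b :=
  fun w => hT.edges_subset_of_isPath hp w h

/-- If an edge separates the images under `φ` of the endpoints of a walk, then it separates the
images of the endpoints of some edge of the walk. -/
theorem Walk.exists_edgeSeparates {V' : Type*} {T' : SimpleGraph V'} (φ : V → V') {a b : V}
    (w : T.Walk a b) {c d : V'} (h : T'.EdgeSeparates c d (φ a) (φ b)) :
    ∃ x y : V, T.Adj x y ∧ s(x, y) ∈ w.edges ∧ T'.EdgeSeparates c d (φ x) (φ y) := by
  induction w with
  | nil => simpa using h .nil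
  | @cons u v w hadj p ih =>
    by_cases h' : T'.EdgeSeparates c d (φ u) (φ v)
    · exact ⟨u, v, hadj, by simp, h'⟩
    · have : T'.EdgeSeparates c d (φ v) (φ w) := by
        intro q
        simp only [EdgeSeparates, not_forall] at h'
        obtain ⟨r, hr⟩ := h'
        have := h (r.append q)
        rw [Walk.edges_append, List.mem_append] at this
        exact this.resolve_left hr
      obtain ⟨x, y, h1, h2, h3⟩ := ih this
      exact ⟨x, y, h1, by simp [h2], h3⟩

namespace IsTree

variable (hT : T.IsTree)

/-- The geodesic from `a` to `b` in a tree. -/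
noncomputable def geodesic (a b : V) : T.Walk a b :=
  (hT.existsUnique_path a b).choose

theorem geodesic_isPath (a b : V) : (hT.geodesic a b).IsPath :=
  (hT.existsUnique_path a b).choose_spec.1

include hT in
theorem path_unique {a b : V} {p q : T.Walk a b} (hp : p.IsPath) (hq : q.IsPath) : p = q :=
  (hT.existsUnique_path a b).unique hp hq

theorem geodesic_map (σ : T ≃g T) (a b : V) :
    hT.geodesic (σ a) (σ b) = (hT.geodesic a b).map σ.toHom :=
  hT.path_unique (hT.geodesic_isPath _ _)
    ((hT.geodesic_isPath a b).map σ.injective)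

theorem length_geodesic_map (σ : T ≃g T) (a b : V) :
    (hT.geodesic (σ a) (σ b)).length = (hT.geodesic a b).length := by
  rw [geodesic_map, Walk.length_map]

theorem getVert_geodesic_map (σ : T ≃g T) (a b : V) (i : ℕ) :
    (hT.geodesic (σ a) (σ b)).getVert i = σ ((hT.geodesic a b).getVert i) := by
  rw [geodesic_map, Walk.getVert_map]; rfl

theorem length_geodesic (a b : V) : (hT.geodesic a b).length = T.dist a b := by
  obtain ⟨p, hp, hl⟩ := hT.connected.exists_path_of_dist a b
  rw [← hl, hT.path_unique (hT.geodesic_isPath a b) hp]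

theorem edgeSeparates_getVert (a b : V) {i : ℕ} (hi : i < (hT.geodesic a b).length) :
    T.EdgeSeparates ((hT.geodesic a b).getVert i) ((hT.geodesic a b).getVert (i + 1)) a b :=
  hT.isAcyclic.edgeSeparates_of_mem_edges (hT.geodesic_isPath a b)
    ((Walk.mk_mem_edges_iff_exists _).2 ⟨i, hi, rfl⟩)

include hT

theorem dist_map_of_fixed {σ : T ≃g T} {a : V} (ha : σ a = a) (x : V) :
    T.dist a (σ x) = T.dist a x := by
  rw [← hT.length_geodesic, ← hT.length_geodesic a x, ← hT.length_geodesic_map σ a x, ha]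

/-- The first cohomology of a tree with coefficients in `ℤ/2` vanishes. -/
theorem exists_coboundary (c : Sym2 V → ZMod 2) :
    ∃ b : V → ZMod 2, ∀ x y, T.Adj x y → c s(x, y) = b x + b y := by
  obtain ⟨r⟩ := hT.connected.nonempty
  refine ⟨fun x => ((hT.geodesic r x).edges.map c).sum, fun x y hxy => ?_⟩
  wlog h : y ∉ (hT.geodesic r x).support generalizing x y
  · rw [add_comm, Sym2.eq_swap]
    refine this y x hxy.symm ?_
    exact hT.isAcyclic.ne_mem_support_of_support_of_adj_of_isPath (hT.geodesic_isPath _ _)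
      (hT.geodesic_isPath _ _) hxy (not_not.1 h)
  · have : hT.geodesic r y = (hT.geodesic r x).concat hxy :=
      hT.path_unique (hT.geodesic_isPath _ _) ((hT.geodesic_isPath _ _).concat h hxy)
    simp only [this, Walk.edges_concat, List.concat_eq_append, List.map_append, List.sum_append,
      List.map_cons, List.map_nil, List.sum_cons, List.sum_nil, add_zero]
    rw [← add_assoc, CharTwo.add_self_eq_zero, zero_add]

/-- A vertex of a tree has at most one neighbour closer to the root `r`. -/
theorem eq_of_adj_of_dist_lt {r x y z : V} (hy : T.Adj x y) (hz : T.Adj x z)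
    (hy' : T.dist r y < T.dist r x) (hz' : T.dist r z < T.dist r x) : y = z := by
  have key : ∀ u, T.Adj x u → T.dist r u < T.dist r x →
      u = (hT.geodesic r x).penultimate := by
    intro u hu hu'
    refine hT.isAcyclic.eq_penultimate_of_adj_end (hT.geodesic_isPath _ _) hu ?_
    obtain ⟨p, hp, hl⟩ := hT.connected.exists_path_of_dist r u
    have : x ∉ p.support := by
      intro hx
      classical
      have h1 := T.dist_le (p.takeUntil x hx)
      have h2 := p.length_takeUntil_le_length hx
      omega
    rw [hT.path_unique (hT.geodesic_isPath r x) (hp.concat this hu.symm)]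
    simp
  rw [key y hy hy', key z hz hz']

/-- Automorphisms of a tree fixing two distinct vertices fix a common edge. -/
theorem exists_adj_fixed {a b : V} (hab : a ≠ b) :
    ∃ v, T.Adj a v ∧ ∀ σ : T ≃g T, σ a = a → σ b = b → σ v = v := by
  have hnil : ¬ (hT.geodesic a b).Nil := Walk.not_nil_of_ne hab
  refine ⟨(hT.geodesic a b).getVert 1, Walk.adj_snd hnil, fun σ ha hb => ?_⟩
  rw [← hT.getVert_geodesic_map, ha, hb]

/-- If some automorphisms of a tree fix a vertex `a` and preserve a non-empty subtree `Z`, then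
they fix the projection of `a` to `Z`. -/
theorem exists_fixed_of_invariant {A : Set (T ≃g T)} {Z : Set V} (hne : Z.Nonempty)
    (hZ : ∀ σ ∈ A, ∀ z ∈ Z, σ z ∈ Z)
    (hconn : ∀ x ∈ Z, ∀ y ∈ Z, ∃ w : T.Walk x y, ∀ v ∈ w.support, v ∈ Z)
    {a : V} (ha : ∀ σ ∈ A, σ a = a) : ∃ z ∈ Z, ∀ σ ∈ A, σ z = z := by
  obtain ⟨y, hy, hmin⟩ : ∃ y ∈ Z, ∀ z ∈ Z, T.dist a y ≤ T.dist a z :=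
    ⟨Function.argminOn (T.dist a) Z hne, Function.argminOn_mem _ _ hne,
      fun z hz => Function.argminOn_le _ _ hz⟩
  refine ⟨y, hy, fun σ hσ => ?_⟩
  have hd : T.dist a (σ y) = T.dist a y := hT.dist_map_of_fixed (ha σ hσ) y
  by_cases hay : a = σ y
  · rw [← hay, SimpleGraph.dist_self, eq_comm, hT.connected.dist_eq_zero_iff] at hd
    rw [← hay, ← hd]
  set p := hT.geodesic a y with hp
  set p' := hT.geodesic a (σ y) with hp'
  have hpl : p.length = T.dist a y := hT.length_geodesic _ _
  have hpl' : p'.length = T.dist a y := (hT.length_geodesic _ _).trans hd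
  have hpos : 0 < p'.length := by
    rw [hpl', ← hd]
    exact (hT.connected.pos_dist_of_ne hay)
  obtain ⟨w, hw⟩ := hconn y hy (σ y) (hZ σ hσ y hy)
  -- The last edge of the geodesic to `σ y` leaves `Z`, so that it lies on the geodesic to `y`.
  have hlast : s(p'.getVert (p'.length - 1), σ y) ∈ p'.edges :=
    (Walk.mk_mem_edges_iff_exists _).2 ⟨p'.length - 1, by omega, by
      rw [Nat.sub_add_cancel hpos, Walk.getVert_length]⟩
  have hmem := hT.isAcyclic.edges_subset_of_isPath (hT.geodesic_isPath _ _) (p.append w) hlast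
  rw [Walk.edges_append, List.mem_append] at hmem
  have hin : σ y ∈ p.support := by
    refine hmem.elim (fun h => p.snd_mem_support_of_mem_edges h) (fun h => ?_)
    exfalso
    have h1 := hmin _ (hw _ (w.fst_mem_support_of_mem_edges h))
    have h2 := T.dist_le (p'.take (p'.length - 1))
    rw [Walk.take_length] at h2
    omega
  obtain ⟨i, hi, hil⟩ := Walk.mem_support_iff_exists_getVert.1 hin
  have h2 := T.dist_le (p.take i)
  rw [Walk.take_length, hi, hd] at h2
  have : i = p.length := by omega
  rw [← hi, this, Walk.getVert_length]

end IsTree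

end SimpleGraph

/-! ### Orbits -/

section Orbits

variable {Γ : Type u} [Group Γ] {A B : Type*} [MulAction Γ A] [MulAction Γ B]

/-- The orbit of a point, as an element of the orbit space. -/
def orbitMk (Γ : Type u) [Group Γ] {A : Type*} [MulAction Γ A] (a : A) :
    MulAction.orbitRel.Quotient Γ A :=
  Quotient.mk'' a

theorem orbitMk_eq_iff {a b : A} : orbitMk Γ a = orbitMk Γ b ↔ ∃ g : Γ, g • b = a := by
  rw [orbitMk, orbitMk, Quotient.eq'']
  exact Iff.rfl

theorem orbitMk_surjective : Function.Surjective (orbitMk Γ : A → _) :=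
  Quotient.mk''_surjective

theorem orbitMk_smul (g : Γ) (a : A) : orbitMk Γ (g • a) = orbitMk Γ a :=
  orbitMk_eq_iff.2 ⟨g, rfl⟩

/-- The map on orbit spaces induced by a map that respects orbits. -/
def orbitMap {B' : Type*} (h : A → B') (hh : ∀ (g : Γ) a, h (g • a) = h a) :
    MulAction.orbitRel.Quotient Γ A → B' :=
  fun o => Quotient.liftOn' o h (by rintro _ b ⟨g, rfl⟩; exact hh g b)

@[simp]
theorem orbitMap_orbitMk {B' : Type*} (h : A → B') (hh : ∀ (g : Γ) a, h (g • a) = h a) (a : A) :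
    orbitMap h hh (orbitMk Γ a) = h a :=
  rfl

theorem orbitMk_val_injective (p : SubMulAction Γ A) :
    Function.Injective (orbitMap (fun x : p => orbitMk Γ (x : A)) fun g x => by
      rw [SubMulAction.val_smul, orbitMk_smul]) := by
  intro x y
  obtain ⟨x, rfl⟩ := orbitMk_surjective x
  obtain ⟨y, rfl⟩ := orbitMk_surjective y
  simp only [orbitMap_orbitMk, orbitMk_eq_iff]
  rintro ⟨g, hg⟩
  exact ⟨g, Subtype.ext hg⟩

instance finite_orbits_subMulAction [Finite (MulAction.orbitRel.Quotient Γ A)]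
    (p : SubMulAction Γ A) : Finite (MulAction.orbitRel.Quotient Γ p) :=
  Finite.of_injective _ (orbitMk_val_injective p)

theorem natCard_orbits_subMulAction_lt [Finite (MulAction.orbitRel.Quotient Γ A)]
    (p : SubMulAction Γ A) {a : A} (ha : a ∉ p) :
    Nat.card (MulAction.orbitRel.Quotient Γ p) < Nat.card (MulAction.orbitRel.Quotient Γ A) := by
  classical
  have := Fintype.ofFinite (MulAction.orbitRel.Quotient Γ p)
  have := Fintype.ofFinite (MulAction.orbitRel.Quotient Γ A)
  rw [Nat.card_eq_fintype_card, Nat.card_eq_fintype_card]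
  refine Fintype.card_lt_of_injective_of_notMem _ (orbitMk_val_injective p)
    (b := orbitMk Γ a) ?_
  rintro ⟨x, hx⟩
  obtain ⟨x, rfl⟩ := orbitMk_surjective x
  simp only [orbitMap_orbitMk, orbitMk_eq_iff] at hx
  obtain ⟨g, hg⟩ := hx
  have h := p.smul_mem g⁻¹ x.2
  rw [inv_smul_eq_iff.2 hg.symm] at h
  exact ha h

/-- The complement of an orbit. -/
def orbitCompl (Γ : Type u) [Group Γ] {A : Type*} [MulAction Γ A] (a : A) : SubMulAction Γ A where
  carrier := {x | orbitMk Γ x ≠ orbitMk Γ a}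
  smul_mem' g x hx := by
    simpa only [Set.mem_ofPred_eq, orbitMk_smul] using hx

theorem mem_orbitCompl {a x : A} : x ∈ orbitCompl Γ a ↔ orbitMk Γ x ≠ orbitMk Γ a := Iff.rfl

end Orbits

/-! ### Graphs with a group action -/

/-- A multigraph with an action of the group `Γ`. The orientation of the edges is part of the
structure only to make notation convenient; as it is preserved by `Γ`, there are no inversions. -/
structure GGraph (Γ : Type u) [Group Γ] where
  /-- The vertices. -/
  V : Type v
  /-- The edges. -/
  E : Type v
  [actV : MulAction Γ V]
  [actE : MulAction Γ E]
  /-- The endpoints of an edge. -/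
  bd : Bool → E → V
  bd_smul : ∀ i (g : Γ) e, bd i (g • e) = g • bd i e

namespace GGraph

attribute [instance] GGraph.actV GGraph.actE

variable {Γ : Type u} [Group Γ] (X : GGraph.{u, v} Γ)

/-- The space of orbits of vertices. -/
abbrev OV := MulAction.orbitRel.Quotient Γ X.V

/-- The space of orbits of edges. -/
abbrev OE := MulAction.orbitRel.Quotient Γ X.E

/-- The coboundary of a `ℤ/2`-valued cochain. -/
def cobd (b : X.V → ZMod 2) (e : X.E) : ZMod 2 := b (X.bd false e) + b (X.bd true e)

theorem cobd_eq (b : X.V → ZMod 2) (i : Bool) (e : X.E) :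
    X.cobd b e = b (X.bd i e) + b (X.bd (!i) e) := by
  cases i
  · rfl
  · exact add_comm _ _

theorem cobd_eq_zero_iff (b : X.V → ZMod 2) (e : X.E) :
    X.cobd b e = 0 ↔ b (X.bd false e) = b (X.bd true e) :=
  CharTwo.add_eq_zero

theorem cobd_add (b b' : X.V → ZMod 2) (e : X.E) :
    X.cobd (fun v => b v + b' v) e = X.cobd b e + X.cobd b' e :=
  add_add_add_comm _ _ _ _

/-- Connectedness, stated as the triviality of the reduced cohomology of degree `0` with
coefficients in `ℤ/2`. -/
structure Conn : Prop where
  nonempty : Nonempty X.V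
  eq_of_cobd : ∀ b : X.V → ZMod 2, (∀ e, X.cobd b e = 0) → ∀ x y, b x = b y

/-- Acyclicity, stated as the vanishing of the first cohomology with coefficients in `ℤ/2`: this
says that the graph is a forest, without loops or multiple edges. -/
def Acyclic : Prop :=
  ∀ c : X.E → ZMod 2, ∃ b : X.V → ZMod 2, ∀ e, X.cobd b e = c e

variable {X} in
/-- In a connected graph a property inherited along edges holds for all or for no vertices. -/
theorem Conn.induction (hX : X.Conn) {P : X.V → Prop}
    (hP : ∀ e, P (X.bd false e) ↔ P (X.bd true e)) {x : X.V} (hx : P x) (y : X.V) : P y := by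
  classical
  have h := hX.eq_of_cobd (fun v => if P v then 1 else 0)
    (fun e => (X.cobd_eq_zero_iff _ e).2 (by simp only [hP e])) x y
  by_contra hy
  simp [hx, hy] at h

/-- A vertex is trivial if its stabilizer is the stabilizer of each incident edge; an isolated
vertex is trivial. -/
def IsTriv (x : X.V) : Prop :=
  ∀ i e, X.bd i e = x → ∀ g : Γ, g • x = x → g • e = e

variable {X} in
theorem IsTriv.smul {x : X.V} (hx : X.IsTriv x) (h : Γ) : X.IsTriv (h • x) := by
  intro i e he g hg
  have h1 : X.bd i (h⁻¹ • e) = x := by rw [X.bd_smul, he, inv_smul_smul]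
  have h2 := hx i _ h1 (h⁻¹ * g * h) (by
    rw [mul_smul, mul_smul, hg, inv_smul_smul])
  rw [mul_smul, smul_inv_smul, mul_smul, smul_left_cancel_iff] at h2
  exact h2

variable {X} in
theorem IsTriv.of_smul {x : X.V} {h : Γ} (hx : X.IsTriv (h • x)) : X.IsTriv x := by
  have := hx.smul h⁻¹
  rwa [inv_smul_smul] at this

/-- The orbits of trivial vertices. -/
def trivOrbits : Set X.OV := orbitMk Γ '' {x | X.IsTriv x}

theorem mem_trivOrbits {x : X.V} : orbitMk Γ x ∈ X.trivOrbits ↔ X.IsTriv x := by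
  refine ⟨?_, fun h => ⟨x, h, rfl⟩⟩
  rintro ⟨y, hy, hxy⟩
  obtain ⟨g, rfl⟩ := orbitMk_eq_iff.1 hxy
  exact IsTriv.of_smul hy

/-- The complexity of a cofinite graph. If the graph is connected, its quotient has first Betti
number `b`, and `n` orbits of vertices are not trivial, then this is `2 b + n - 2`. -/
noncomputable def complexity : ℤ :=
  2 * Nat.card X.OE - Nat.card X.OV - X.trivOrbits.ncard

/-- A graph is cofinite if it has finitely many orbits of vertices and of edges. -/
structure Cofinite : Prop where
  finV : Finite X.OV
  finE : Finite X.OE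

variable {X}

theorem natCard_OV_le (hX : X.Conn) (hf : X.Cofinite) : Nat.card X.OV ≤ Nat.card X.OE + 1 := by
  have := hf.finV
  have := hf.finE
  have := Fintype.ofFinite X.OV
  have := Fintype.ofFinite X.OE
  -- The coboundary of the quotient graph; its kernel consists of the constants.
  let L : (X.OV → ZMod 2) →ₗ[ZMod 2] (X.OE → ZMod 2) :=
    { toFun := fun b => orbitMap (X.cobd fun v => b (orbitMk Γ v)) (fun g e => by
        simp only [cobd, bd_smul, orbitMk_smul])
      map_add' := fun b b' => by
        ext o
        obtain ⟨e, rfl⟩ := orbitMk_surjective o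
        exact add_add_add_comm _ _ _ _
      map_smul' := fun r b => by
        ext o
        obtain ⟨e, rfl⟩ := orbitMk_surjective o
        exact (mul_add _ _ _).symm }
  have hker : LinearMap.ker L ≤ Submodule.span (ZMod 2) {fun _ => 1} := by
    intro b hb
    rw [LinearMap.mem_ker] at hb
    obtain ⟨x₀⟩ := hX.nonempty
    rw [Submodule.mem_span_singleton]
    refine ⟨b (orbitMk Γ x₀), ?_⟩
    ext o
    obtain ⟨x, rfl⟩ := orbitMk_surjective o
    simp only [Pi.smul_apply, smul_eq_mul, mul_one]
    exact hX.eq_of_cobd (fun v => b (orbitMk Γ v))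
      (fun e => congrFun hb (orbitMk Γ e)) _ _
  have h1 := Submodule.finrank_mono hker
  have h2 := finrank_span_le_card (R := ZMod 2) {fun _ : X.OV => (1 : ZMod 2)}
  rw [Set.toFinset_singleton, Finset.card_singleton] at h2
  have h3 := LinearMap.finrank_range_add_finrank_ker L
  have h4 := Submodule.finrank_le (LinearMap.range L)
  rw [Module.finrank_fintype_fun_eq_card, ← Nat.card_eq_fintype_card] at h3 h4
  omega

theorem neg_two_le_complexity (hX : X.Conn) (hf : X.Cofinite) : -2 ≤ X.complexity := by
  have := hf.finV
  have h1 := natCard_OV_le hX hf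
  have h2 : X.trivOrbits.ncard ≤ Nat.card X.OV := Set.ncard_le_card _
  rw [complexity]
  omega

/-- Given a `Γ`-map from the vertices to another set, the graph on this set obtained by keeping
some of the edges. -/
def push (X : GGraph.{u, v} Γ) {V' : Type v} [MulAction Γ V'] (q : X.V → V')
    (hq : ∀ (g : Γ) x, q (g • x) = g • q x) (p : SubMulAction Γ X.E) : GGraph.{u, v} Γ where
  V := V'
  E := p
  bd i e := q (X.bd i e)
  bd_smul i g e := by rw [SubMulAction.val_smul, X.bd_smul, hq]

end GGraph

/-! ### Graphs over a tree -/

namespace GGraph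

variable {Γ : Type u} [Group Γ] {X : GGraph.{u, v} Γ}

/-- An equivariant map from a graph to a tree sending each edge to a vertex or to an edge, in such a
way that an edge that is not collapsed has the same stabilizer as its image. -/
structure Over (X : GGraph.{u, v} Γ) {W : Type*} (S : TreeAction Γ W) where
  /-- The map on vertices. -/
  f : X.V → W
  map_smul : ∀ (g : Γ) x, f (g • x) = S.act g (f x)
  adj : ∀ e, f (X.bd false e) = f (X.bd true e) ∨ S.tree.Adj (f (X.bd false e)) (f (X.bd true e))
  stab : ∀ e, S.tree.Adj (f (X.bd false e)) (f (X.bd true e)) → ∀ g : Γ,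
    S.act g (f (X.bd false e)) = f (X.bd false e) →
    S.act g (f (X.bd true e)) = f (X.bd true e) → g • e = e

/-- A subgroup is elliptic if it fixes a vertex. -/
def Elliptic (X : GGraph.{u, v} Γ) (A : Subgroup Γ) : Prop :=
  ∃ x : X.V, ∀ g ∈ A, g • x = x

section Push

variable {V' : Type v} [MulAction Γ V'] {q : X.V → V'} {hq : ∀ (g : Γ) x, q (g • x) = g • q x}
  {p : SubMulAction Γ X.E}

theorem Conn.push (hX : X.Conn) (hsurj : Function.Surjective q)
    (h : ∀ b : V' → ZMod 2, (∀ e ∈ p, X.cobd (fun v => b (q v)) e = 0) →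
      ∀ e, X.cobd (fun v => b (q v)) e = 0) : (X.push q hq p).Conn where
  nonempty := hX.nonempty.map q
  eq_of_cobd b hb x y := by
    obtain ⟨x, rfl⟩ := hsurj x
    obtain ⟨y, rfl⟩ := hsurj y
    exact hX.eq_of_cobd (fun v => b (q v)) (h b fun e he => hb ⟨e, he⟩) x y

theorem Cofinite.push (hX : X.Cofinite) (hsurj : Function.Surjective q) :
    (X.push q hq p).Cofinite where
  finV := by
    have := hX.finV
    refine Finite.of_surjective (α := X.OV)
      (orbitMap (fun x => orbitMk Γ (q x)) fun g x =>
        (congrArg _ (hq g x)).trans (orbitMk_smul (A := V') g (q x))) ?_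
    intro o
    obtain ⟨y, rfl⟩ := orbitMk_surjective o
    obtain ⟨x, rfl⟩ := hsurj y
    exact ⟨orbitMk Γ x, rfl⟩
  finE := by
    have := hX.finE
    exact finite_orbits_subMulAction p

/-- A map to a tree descends to a quotient. -/
def Over.push {W : Type*} {S : TreeAction Γ W} (F : X.Over S) (hsurj : Function.Surjective q)
    (f' : V' → W) (hf' : ∀ x, f' (q x) = F.f x) : (X.push q hq p).Over S where
  f := f'
  map_smul g y := by
    obtain ⟨x, rfl⟩ := hsurj y
    exact (congrArg f' (hq g x).symm).trans ((hf' _).trans ((F.map_smul g x).trans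
      (congrArg _ (hf' x).symm)))
  adj e := by
    change f' (q _) = f' (q _) ∨ S.tree.Adj (f' (q _)) (f' (q _))
    simpa only [hf'] using F.adj e.1
  stab e := by
    change S.tree.Adj (f' (q _)) (f' (q _)) → ∀ g, S.act g (f' (q _)) = f' (q _) →
      S.act g (f' (q _)) = f' (q _) → g • e = e
    simp only [hf']
    exact fun h g h1 h2 => Subtype.ext (F.stab e.1 h g h1 h2)

end Push

/-! ### Merging vertices -/

/-- The identification of the vertex `w₁`, an endpoint of `e₁`, with the vertex `w₂`. The edge `e₁`
becomes either a loop or parallel to an edge `e₂`, and will be removed; the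
relation `cobd` expresses that `e₁`, or the path formed by `e₁` and `e₂`, goes from `w₁` to `w₂`. If
one of the vertices is trivial, then its stabilizer fixes this path and therefore the other vertex.
-/
structure MergeData (X : GGraph.{u, v} Γ) (e₁ : X.E) (w₁ w₂ : X.V) : Prop where
  inc : ∃ i, X.bd i e₁ = w₁
  cobd : ∃ o : Option X.E, (∀ e₂ ∈ o, orbitMk Γ e₂ ≠ orbitMk Γ e₁ ∧
    ∀ g : Γ, g • e₁ = e₁ → g • e₂ = e₂) ∧
    ∀ b, X.cobd b e₁ + o.elim 0 (X.cobd b) = b w₁ + b w₂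
  stab₁ : X.IsTriv w₁ → ∀ g : Γ, g • w₁ = w₁ → g • w₂ = w₂
  stab₂ : X.IsTriv w₂ → ∀ g : Γ, g • w₂ = w₂ → g • w₁ = w₁

namespace MergeData

variable {e₁ : X.E} {w₁ w₂ : X.V}

theorem exists_option (D : X.MergeData e₁ w₁ w₂) : ∃ o : Option X.E,
    (∀ e₂ ∈ o, ∀ g : Γ, g • e₂ ∈ orbitCompl Γ e₁) ∧
    (∀ e₂ ∈ o, ∀ g : Γ, g • e₁ = e₁ → g • e₂ = e₂) ∧
    ∀ b (g : Γ), X.cobd b (g • e₁) + o.elim 0 (fun e₂ => X.cobd b (g • e₂)) =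
      b (g • w₁) + b (g • w₂) := by
  obtain ⟨o, ho, hb⟩ := D.cobd
  refine ⟨o, fun e₂ he g => ?_, fun e₂ he => (ho e₂ he).2, fun b g => ?_⟩
  · rw [mem_orbitCompl, orbitMk_smul]
    exact (ho e₂ he).1
  · have := hb fun v => b (g • v)
    cases o <;> simpa only [GGraph.cobd, bd_smul, Option.elim_none, Option.elim_some] using this

/-- The edges that are removed do not matter for connectedness. -/
theorem cobd_eq_zero (D : X.MergeData e₁ w₁ w₂) {b : X.V → ZMod 2}
    (hb : ∀ g : Γ, b (g • w₁) = b (g • w₂)) (h : ∀ e ∈ orbitCompl Γ e₁, X.cobd b e = 0) (e : X.E) :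
    X.cobd b e = 0 := by
  by_cases he : e ∈ orbitCompl Γ e₁
  · exact h e he
  · rw [mem_orbitCompl, not_not, orbitMk_eq_iff] at he
    obtain ⟨g, rfl⟩ := he
    obtain ⟨o, ho, -, ho'⟩ := D.exists_option
    have := ho' b g
    rw [hb, CharTwo.add_self_eq_zero] at this
    cases o with
    | none => simpa using this
    | some e₂ => simpa [h _ (ho e₂ rfl g)] using this

end MergeData

section MergeTriv

variable {e₁ : X.E} {w₁ w₂ : X.V}

open Classical in
/-- The retraction onto the complement of the orbit of `w₁` that sends `w₁` to `w₂`. -/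
noncomputable def retract (hw : orbitMk Γ w₁ ≠ orbitMk Γ w₂) (x : X.V) : orbitCompl Γ w₁ :=
  if h : ∃ g : Γ, g • w₁ = x then
    ⟨h.choose • w₂, by rw [mem_orbitCompl, orbitMk_smul]; exact hw.symm⟩
  else ⟨x, by rw [mem_orbitCompl, ne_eq, orbitMk_eq_iff]; exact h⟩

variable (hw : orbitMk Γ w₁ ≠ orbitMk Γ w₂)

theorem retract_smul_left (h₁ : ∀ g : Γ, g • w₁ = w₁ → g • w₂ = w₂) (g : Γ) :
    (retract hw (g • w₁) : X.V) = g • w₂ := by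
  have h : ∃ g' : Γ, g' • w₁ = g • w₁ := ⟨g, rfl⟩
  rw [retract, dif_pos h]
  have := h₁ (g⁻¹ * h.choose) (by rw [mul_smul, h.choose_spec, inv_smul_smul])
  rwa [mul_smul, inv_smul_eq_iff] at this

theorem retract_of_mem {x : X.V} (hx : x ∈ orbitCompl Γ w₁) : retract hw x = ⟨x, hx⟩ := by
  rw [mem_orbitCompl, ne_eq, orbitMk_eq_iff] at hx
  rw [retract, dif_neg hx]

theorem retract_smul (h₁ : ∀ g : Γ, g • w₁ = w₁ → g • w₂ = w₂) (g : Γ) (x : X.V) :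
    retract hw (g • x) = g • retract hw x := by
  by_cases hx : x ∈ orbitCompl Γ w₁
  · rw [retract_of_mem hw hx, retract_of_mem hw ((orbitCompl Γ w₁).smul_mem g hx)]
    rfl
  · rw [mem_orbitCompl, not_not, orbitMk_eq_iff] at hx
    obtain ⟨h, rfl⟩ := hx
    apply Subtype.ext
    rw [SubMulAction.val_smul, retract_smul_left hw h₁, ← mul_smul, retract_smul_left hw h₁,
      mul_smul]

theorem retract_surjective : Function.Surjective (retract hw) := fun y =>
  ⟨y, retract_of_mem hw y.2⟩

/-- If the vertex `w₁` is trivial and is not a translate of `w₂`, then identifying it with `w₂`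
changes neither the homotopy type of the graph nor the elliptic subgroups, and does not increase the
complexity: an orbit of trivial vertices and an orbit of edges disappear. -/
theorem exists_merge_of_isTriv {W : Type*} {S : TreeAction Γ W} (F : X.Over S)
    (hX : X.Conn) (hf : X.Cofinite) (D : X.MergeData e₁ w₁ w₂) (hF : F.f w₁ = F.f w₂)
    (hw : orbitMk Γ w₁ ≠ orbitMk Γ w₂) (ht : X.IsTriv w₁) :
    ∃ Y : GGraph.{u, v} Γ, Nonempty (Y.Over S) ∧ Y.Conn ∧ Y.Cofinite ∧
      Nat.card Y.OE < Nat.card X.OE ∧ Y.complexity ≤ X.complexity ∧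
      (Y.Acyclic → X.Acyclic) ∧ ∀ A, Y.Elliptic A → X.Elliptic A := by
  have hV := hf.finV
  have hE := hf.finE
  have h₁ := D.stab₁ ht
  have hleft := retract_smul_left hw h₁
  have hw₂ : ∀ g : Γ, g • w₂ ∈ orbitCompl Γ w₁ := fun g => by
    rw [mem_orbitCompl, orbitMk_smul]; exact hw.symm
  have hright : ∀ g : Γ, (retract hw (g • w₂) : X.V) = g • w₂ := fun g => by
    rw [retract_of_mem hw (hw₂ g)]
  have heq : ∀ g : Γ, retract hw (g • w₁) = retract hw (g • w₂) := fun g =>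
    Subtype.ext (by rw [hleft, hright])
  have hsurj := retract_surjective hw
  let Y := X.push (retract hw) (retract_smul hw h₁) (orbitCompl Γ e₁)
  have hYf : Y.Cofinite := hf.push hsurj
  have hcardE : Nat.card Y.OE < Nat.card X.OE :=
    natCard_orbits_subMulAction_lt (orbitCompl Γ e₁) (a := e₁) (by simp [mem_orbitCompl])
  refine ⟨Y, ⟨F.push hsurj (fun y => F.f y) fun x => ?_⟩, hX.push hsurj fun b hb => ?_, hYf,
    hcardE, ?_, ?_, ?_⟩
  · by_cases hx : x ∈ orbitCompl Γ w₁
    · rw [retract_of_mem hw hx]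
    · rw [mem_orbitCompl, not_not, orbitMk_eq_iff] at hx
      obtain ⟨h, rfl⟩ := hx
      rw [hleft, F.map_smul, F.map_smul, hF]
  · exact D.cobd_eq_zero (b := fun v => b (retract hw v)) (fun g => congrArg b (heq g)) hb
  · -- A trivial vertex outside the orbit of `w₁` stays trivial.
    have htriv : ∀ x : Y.V, X.IsTriv x.1 → Y.IsTriv x := by
      intro x hx i e he g hg
      replace hg : g • x.1 = x.1 := congrArg Subtype.val hg
      apply Subtype.ext
      change g • e.1 = e.1
      replace he : retract hw (X.bd i e.1) = x := he
      by_cases hm : X.bd i e.1 ∈ orbitCompl Γ w₁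
      · rw [retract_of_mem hw hm] at he
        exact hx i e.1 (congrArg Subtype.val he) g hg
      · rw [mem_orbitCompl, not_not, orbitMk_eq_iff] at hm
        obtain ⟨h, hh⟩ := hm
        rw [← hh] at he
        replace he := congrArg Subtype.val he
        rw [hleft] at he
        refine ht.smul h i e.1 hh.symm g ?_
        rw [← he] at hx hg
        have := D.stab₂ hx.of_smul (h⁻¹ * g * h) (by
          rw [mul_smul, mul_smul, hg, inv_smul_smul])
        rwa [mul_smul, mul_smul, inv_smul_eq_iff] at this
    let ι : Y.OV → X.OV := orbitMap (fun x : orbitCompl Γ w₁ => orbitMk Γ (x : X.V))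
      fun g x => orbitMk_smul g x.1
    have hc1 : Nat.card X.OV ≤ Nat.card Y.OV + 1 := by
      have hYV := hYf.finV
      have h1 : (Set.univ : Set X.OV) ⊆ insert (orbitMk Γ w₁) (ι '' Set.univ) := by
        intro o _
        obtain ⟨x, rfl⟩ := orbitMk_surjective o
        by_cases hx : x ∈ orbitCompl Γ w₁
        · exact Or.inr ⟨orbitMk Γ (⟨x, hx⟩ : orbitCompl Γ w₁), trivial, rfl⟩
        · exact Or.inl (not_not.1 hx)
      have h2 := Set.ncard_le_ncard h1
      have h3 := Set.ncard_insert_le (orbitMk Γ w₁) (ι '' Set.univ)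
      have h4 := Set.ncard_image_le (f := ι) (Set.toFinite Set.univ)
      rw [Set.ncard_univ] at h2 h4
      omega
    have hc2 : X.trivOrbits.ncard ≤ Y.trivOrbits.ncard + 1 := by
      have hYV := hYf.finV
      have h1 : X.trivOrbits ⊆ insert (orbitMk Γ w₁) (ι '' Y.trivOrbits) := by
        rintro _ ⟨x, hx, rfl⟩
        by_cases hx' : x ∈ orbitCompl Γ w₁
        · exact Or.inr ⟨orbitMk Γ (⟨x, hx'⟩ : orbitCompl Γ w₁),
            (Y.mem_trivOrbits).2 (htriv ⟨x, hx'⟩ hx), rfl⟩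
        · exact Or.inl (not_not.1 hx')
      have h2 := Set.ncard_le_ncard h1
      have h3 := Set.ncard_insert_le (orbitMk Γ w₁) (ι '' Y.trivOrbits)
      have h4 := Set.ncard_image_le (f := ι) (Set.toFinite Y.trivOrbits)
      omega
    rw [complexity, complexity]
    omega
  · intro hY c
    obtain ⟨o, ho, hos, hob⟩ := D.exists_option
    classical
    -- Let `b₀` vanish outside the orbit of `w₁`, where its value is the integral of `c` along the
    -- path from `w₁` to `w₂`; this depends only on the vertex because `w₁` is trivial. Then the
    -- class of `c` is represented by a cochain that descends to `Y`, and `b₀` corrects for the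
    -- difference.
    let κ : Γ → ZMod 2 := fun g => c (g • e₁) + o.elim 0 (fun e₂ => c (g • e₂))
    let b₀ : X.V → ZMod 2 := fun x => if h : ∃ g : Γ, g • w₁ = x then κ h.choose else 0
    have hb₀ : ∀ g : Γ, b₀ (g • w₁) = κ g := by
      intro g
      have h : ∃ g' : Γ, g' • w₁ = g • w₁ := ⟨g, rfl⟩
      obtain ⟨i, hi⟩ := D.inc
      have h1 : (g⁻¹ * h.choose) • e₁ = e₁ :=
        ht i e₁ hi _ (by rw [mul_smul, h.choose_spec, inv_smul_smul])
      have key : ∀ e : X.E, (g⁻¹ * h.choose) • e = e → h.choose • e = g • e := fun e he => by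
        rwa [mul_smul, inv_smul_eq_iff] at he
      simp only [b₀, dif_pos h, κ]
      rw [key _ h1]
      cases o with
      | none => rfl
      | some e₂ => simp only [Option.elim_some]; rw [key _ (hos e₂ rfl _ h1)]
    have hb₀' : ∀ g : Γ, b₀ (g • w₂) = 0 := by
      intro g
      have := hw₂ g
      rw [mem_orbitCompl, ne_eq, orbitMk_eq_iff] at this
      simp only [b₀, dif_neg this]
    obtain ⟨b, hb⟩ := hY fun e => c e.1 + X.cobd b₀ e.1
    have hmem : ∀ e ∈ orbitCompl Γ e₁, X.cobd (fun v => b (retract hw v) + b₀ v) e = c e := by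
      intro e he
      have h1 : X.cobd (fun v => b (retract hw v)) e = c e + X.cobd b₀ e := hb ⟨e, he⟩
      rw [X.cobd_add, h1, add_assoc, CharTwo.add_self_eq_zero, add_zero]
    refine ⟨fun v => b (retract hw v) + b₀ v, fun e => ?_⟩
    by_cases he : e ∈ orbitCompl Γ e₁
    · exact hmem e he
    · rw [mem_orbitCompl, not_not, orbitMk_eq_iff] at he
      obtain ⟨g, rfl⟩ := he
      have h1 := hob (fun v => b (retract hw v) + b₀ v) g
      simp only [hb₀, hb₀', heq, κ] at h1
      cases o with
      | none =>
        simp only [Option.elim_none, add_zero] at h1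
        rw [h1, add_right_comm, CharTwo.add_self_eq_zero, zero_add]
      | some e₂ =>
        simp only [Option.elim_some, hmem _ (ho e₂ rfl g), add_zero] at h1
        rw [add_right_comm, CharTwo.add_self_eq_zero, zero_add] at h1
        exact add_right_cancel h1
  · rintro A ⟨y, hy⟩
    exact ⟨y.1, fun g hg => congrArg Subtype.val (hy g hg)⟩

end MergeTriv

end GGraph

namespace GGraph

variable {Γ : Type u} [Group Γ] {X : GGraph.{u, v} Γ}

section Quot

variable {A : Type*} [MulAction Γ A]

/-- The action on the quotient by an invariant relation. -/
@[reducible]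
def quotAction (r : A → A → Prop) (hr : ∀ (g : Γ) x y, r x y → r (g • x) (g • y)) :
    MulAction Γ (Quot r) where
  smul g := Quot.map (g • ·) (hr g)
  one_smul := by rintro ⟨x⟩; exact congrArg _ (one_smul Γ x)
  mul_smul g h := by rintro ⟨x⟩; exact congrArg _ (mul_smul g h x)

/-- The relation between the translates of two points. -/
def mergeRel (Γ : Type u) [Group Γ] {A : Type*} [MulAction Γ A] (a b x y : A) : Prop :=
  ∃ g : Γ, x = g • a ∧ y = g • b

/-- The quotient of a `Γ`-set obtained by identifying `g • a` with `g • b` for all `g : Γ`. -/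
def MergeQuot (Γ : Type u) [Group Γ] {A : Type*} [MulAction Γ A] (a b : A) : Type _ :=
  Quot (mergeRel Γ a b)

instance (a b : A) : MulAction Γ (MergeQuot Γ a b) :=
  quotAction _ (by rintro g _ _ ⟨h, rfl, rfl⟩; exact ⟨g * h, (mul_smul _ _ _).symm,
    (mul_smul _ _ _).symm⟩)

/-- The projection to the quotient identifying `a` with `b`. -/
def mergeMk (Γ : Type u) [Group Γ] {A : Type*} [MulAction Γ A] (a b x : A) : MergeQuot Γ a b :=
  Quot.mk _ x

theorem mergeMk_smul (a b : A) (g : Γ) (x : A) : mergeMk Γ a b (g • x) = g • mergeMk Γ a b x :=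
  rfl

theorem mergeMk_surjective (a b : A) : Function.Surjective (mergeMk Γ a b) :=
  Quot.mk_surjective

theorem mergeMk_eq (a b : A) (g : Γ) : mergeMk Γ a b (g • a) = mergeMk Γ a b (g • b) :=
  Quot.sound ⟨g, rfl, rfl⟩

/-- A function identifying `g • a` with `g • b` descends to the quotient. -/
def mergeLift {B : Type*} {a b : A} (h : A → B) (hh : ∀ g : Γ, h (g • a) = h (g • b)) :
    MergeQuot Γ a b → B :=
  Quot.lift h (by rintro _ _ ⟨g, rfl, rfl⟩; exact hh g)

/-- Outside the orbits of `a` and `b` nothing is identified. -/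
theorem eq_of_mergeMk_eq {a b x y : A} (ha : orbitMk Γ x ≠ orbitMk Γ a)
    (hb : orbitMk Γ x ≠ orbitMk Γ b) (h : mergeMk Γ a b y = mergeMk Γ a b x) : y = x := by
  let P : MergeQuot Γ a b → Prop := mergeLift (· = x) (fun g => by
    refine propext ⟨fun h => ?_, fun h => ?_⟩
    · exact (ha (by rw [← h, orbitMk_smul])).elim
    · exact (hb (by rw [← h, orbitMk_smul])).elim)
  have h2 : P (mergeMk Γ a b x) := rfl
  rw [← h] at h2
  exact h2

end Quot

variable {e₁ : X.E} {w₁ w₂ : X.V}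

/-- Identifying two vertices of which neither is trivial, or which are translates of each other,
decreases the complexity: an orbit of edges disappears, and at most one of the number of orbits of
vertices and the number of orbits of trivial vertices decreases, by one. -/
theorem exists_merge_of_not_isTriv {W : Type*} {S : TreeAction Γ W} (F : X.Over S)
    (hX : X.Conn) (hf : X.Cofinite) (D : X.MergeData e₁ w₁ w₂) (hF : F.f w₁ = F.f w₂)
    (hw : orbitMk Γ w₁ = orbitMk Γ w₂ ∨ ¬ X.IsTriv w₁ ∧ ¬ X.IsTriv w₂) :
    ∃ Y : GGraph.{u, v} Γ, Nonempty (Y.Over S) ∧ Y.Conn ∧ Y.Cofinite ∧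
      Y.complexity < X.complexity := by
  have hV := hf.finV
  have hE := hf.finE
  have hsurj := mergeMk_surjective (Γ := Γ) w₁ w₂
  let Y := X.push (mergeMk Γ w₁ w₂) (mergeMk_smul w₁ w₂) (orbitCompl Γ e₁)
  have hYf : Y.Cofinite := hf.push hsurj
  have hcardE : Nat.card Y.OE < Nat.card X.OE :=
    natCard_orbits_subMulAction_lt (orbitCompl Γ e₁) (a := e₁) (by simp [mem_orbitCompl])
  refine ⟨Y, ⟨F.push hsurj (mergeLift F.f fun g => by rw [F.map_smul, F.map_smul, hF])
    fun x => rfl⟩, hX.push hsurj fun b hb => ?_, hYf, ?_⟩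
  · exact D.cobd_eq_zero (b := fun v => b (mergeMk Γ w₁ w₂ v))
      (fun g => congrArg b (mergeMk_eq _ _ g)) hb
  · have htriv : ∀ x : X.V, orbitMk Γ x ≠ orbitMk Γ w₁ → orbitMk Γ x ≠ orbitMk Γ w₂ →
        X.IsTriv x → Y.IsTriv (mergeMk Γ w₁ w₂ x) := by
      intro x h1 h2 hx i e he g hg
      have he' : X.bd i e.1 = x := eq_of_mergeMk_eq h1 h2 he
      have hg' : g • x = x := eq_of_mergeMk_eq h1 h2 hg
      exact Subtype.ext (hx i e.1 he' g hg')
    classical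
    -- A section of the map on orbit spaces, defined outside the orbit of `w₁`.
    let h₀ : X.V → X.OV := fun x =>
      if orbitMk Γ x = orbitMk Γ w₁ then orbitMk Γ w₂ else orbitMk Γ x
    have hh₀ : ∀ (g : Γ) x, h₀ (g • x) = h₀ x := fun g x => by simp only [h₀, orbitMk_smul]
    let ψ : Y.OV → X.OV := orbitMap (mergeLift h₀ fun g => by
        simp only [h₀, orbitMk_smul, if_true]
        split_ifs <;> rfl) (by
      intro g y
      obtain ⟨x, rfl⟩ := hsurj y
      exact hh₀ g x)
    have hψ : ∀ x, ψ (orbitMk Γ (mergeMk Γ w₁ w₂ x)) = h₀ x := fun x => rfl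
    have hψ' : ∀ x, orbitMk Γ x ≠ orbitMk Γ w₁ → ψ (orbitMk Γ (mergeMk Γ w₁ w₂ x)) =
        orbitMk Γ x := fun x hx => by rw [hψ]; exact if_neg hx
    have hYV := hYf.finV
    have hu := Set.ncard_image_le (f := ψ) (Set.toFinite Set.univ)
    have ht := Set.ncard_image_le (f := ψ) (Set.toFinite Y.trivOrbits)
    rw [Set.ncard_univ] at hu
    rw [complexity, complexity]
    rcases hw with hw | ⟨hw₁, hw₂⟩
    · have h1 : (Set.univ : Set X.OV) ⊆ ψ '' Set.univ := by
        intro o _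
        obtain ⟨x, rfl⟩ := orbitMk_surjective o
        refine ⟨orbitMk Γ (mergeMk Γ w₁ w₂ x), trivial, ?_⟩
        by_cases hx : orbitMk Γ x = orbitMk Γ w₁
        · rw [hψ, hx, hw]
          simp only [h₀, hx, if_true, hw]
        · exact hψ' x hx
      have h2 : X.trivOrbits ⊆ insert (orbitMk Γ w₁) (ψ '' Y.trivOrbits) := by
        rintro _ ⟨x, hx, rfl⟩
        by_cases hx' : orbitMk Γ x = orbitMk Γ w₁
        · exact Or.inl hx'
        · exact Or.inr ⟨_, (Y.mem_trivOrbits).2 (htriv x hx' (hw ▸ hx') hx), hψ' x hx'⟩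
      have h3 := Set.ncard_le_ncard h1
      have h4 := Set.ncard_le_ncard h2
      have h5 := Set.ncard_insert_le (orbitMk Γ w₁) (ψ '' Y.trivOrbits)
      rw [Set.ncard_univ] at h3
      omega
    · have h1 : (Set.univ : Set X.OV) ⊆ insert (orbitMk Γ w₁) (ψ '' Set.univ) := by
        intro o _
        obtain ⟨x, rfl⟩ := orbitMk_surjective o
        by_cases hx : orbitMk Γ x = orbitMk Γ w₁
        · exact Or.inl hx
        · exact Or.inr ⟨_, trivial, hψ' x hx⟩
      have h2 : X.trivOrbits ⊆ ψ '' Y.trivOrbits := by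
        rintro _ ⟨x, hx, rfl⟩
        have hn : ∀ w, ¬ X.IsTriv w → orbitMk Γ x ≠ orbitMk Γ w := by
          intro w hw h
          rw [← X.mem_trivOrbits, ← h, X.mem_trivOrbits] at hw
          exact hw hx
        exact ⟨_, (Y.mem_trivOrbits).2 (htriv x (hn _ hw₁) (hn _ hw₂) hx), hψ' x (hn _ hw₁)⟩
      have h3 := Set.ncard_le_ncard h1
      have h4 := Set.ncard_le_ncard h2
      have h5 := Set.ncard_insert_le (orbitMk Γ w₁) (ψ '' Set.univ)
      rw [Set.ncard_univ] at h3
      omega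

end GGraph

/-! ### Collapses and folds -/

namespace GGraph

variable {Γ : Type u} [Group Γ] {X : GGraph.{u, v} Γ} {W : Type*} {S : TreeAction Γ W}

namespace Over

variable (F : X.Over S)

theorem adj_bd (F : X.Over S) {e : X.E} (he : F.f (X.bd false e) ≠ F.f (X.bd true e)) (i : Bool) :
    S.tree.Adj (F.f (X.bd i e)) (F.f (X.bd (!i) e)) := by
  have := (F.adj e).resolve_left he
  cases i
  · exact this
  · exact this.symm

theorem smul_eq_of_fixed {e : X.E} {i : Bool}
    (h : S.tree.Adj (F.f (X.bd i e)) (F.f (X.bd (!i) e))) {g : Γ}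
    (h1 : S.act g (F.f (X.bd i e)) = F.f (X.bd i e))
    (h2 : S.act g (F.f (X.bd (!i) e)) = F.f (X.bd (!i) e)) : g • e = e := by
  cases i
  · exact F.stab e h g h1 h2
  · exact F.stab e h.symm g h2 h1

theorem act_of_smul_eq {e : X.E} {g : Γ} (hg : g • e = e) (i : Bool) :
    S.act g (F.f (X.bd i e)) = F.f (X.bd i e) := by
  rw [← F.map_smul, ← X.bd_smul, hg]

/-- Two distinct edges with a common endpoint and the same image in the tree. -/
structure IsFold (i j : Bool) (e₁ e₂ : X.E) : Prop where
  ne : e₁ ≠ e₂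
  bd_eq : X.bd i e₁ = X.bd j e₂
  f_eq : F.f (X.bd (!i) e₁) = F.f (X.bd (!j) e₂)
  adj : S.tree.Adj (F.f (X.bd i e₁)) (F.f (X.bd (!i) e₁))

variable {F} {i j : Bool} {e₁ e₂ : X.E}

theorem IsFold.symm (h : F.IsFold i j e₁ e₂) : F.IsFold j i e₂ e₁ where
  ne := h.ne.symm
  bd_eq := h.bd_eq.symm
  f_eq := h.f_eq.symm
  adj := by rw [← h.bd_eq, ← h.f_eq]; exact h.adj

theorem IsFold.smul_eq (h : F.IsFold i j e₁ e₂) {g : Γ} (hg : g • e₁ = e₁) : g • e₂ = e₂ := by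
  refine F.smul_eq_of_fixed h.symm.adj ?_ ?_
  · rw [← h.bd_eq]; exact F.act_of_smul_eq hg i
  · rw [← h.f_eq]; exact F.act_of_smul_eq hg (!i)

/-- Two edges that can be folded are never translates of each other: a translation would either
fix their common image, hence both edges, or invert it. -/
theorem IsFold.orbitMk_ne (h : F.IsFold i j e₁ e₂) : orbitMk Γ e₂ ≠ orbitMk Γ e₁ := by
  rw [ne_eq, orbitMk_eq_iff]
  rintro ⟨g, hg⟩
  have h1 : ∀ k, S.act g (F.f (X.bd k e₁)) = F.f (X.bd k e₂) := fun k => by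
    rw [← F.map_smul, ← X.bd_smul, hg]
  by_cases hij : i = j
  · subst hij
    have : g • e₁ = e₁ := F.smul_eq_of_fixed h.adj (by rw [h1, h.bd_eq]) (by rw [h1, h.f_eq])
    exact h.ne (this.symm.trans hg)
  · obtain rfl : j = !i := by cases i <;> cases j <;> simp_all
    refine S.noInversion g _ _ h.adj ⟨?_, ?_⟩
    · rw [h1, h.f_eq, Bool.not_not]
    · rw [h1, h.bd_eq]

theorem IsFold.mergeData (h : F.IsFold i j e₁ e₂) :
    X.MergeData e₁ (X.bd (!i) e₁) (X.bd (!j) e₂) where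
  inc := ⟨_, rfl⟩
  cobd := by
    refine ⟨some e₂, ?_, fun b => ?_⟩
    · intro e he
      obtain rfl := Option.mem_some_iff.1 he
      exact ⟨h.orbitMk_ne, fun g hg => h.smul_eq hg⟩
    · rw [Option.elim_some, X.cobd_eq b i, X.cobd_eq b j, h.bd_eq, add_add_add_comm,
        CharTwo.add_self_eq_zero, zero_add]
  stab₁ ht g hg := by rw [← X.bd_smul, h.smul_eq (ht _ _ rfl g hg)]
  stab₂ ht g hg := by rw [← X.bd_smul, h.symm.smul_eq (ht _ _ rfl g hg)]

end Over

theorem mergeData_collapse (e : X.E) (i : Bool) :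
    X.MergeData e (X.bd i e) (X.bd (!i) e) where
  inc := ⟨i, rfl⟩
  cobd := ⟨none, by simp, fun b => by rw [Option.elim_none, add_zero, X.cobd_eq b i]⟩
  stab₁ ht g hg := by rw [← X.bd_smul, ht _ _ rfl g hg]
  stab₂ ht g hg := by rw [← X.bd_smul, ht _ _ rfl g hg]

/-! ### Graphs of minimal complexity -/

/-- The complexity of `X` is minimal among the connected cofinite graphs over the tree. -/
def IsMinimal (X : GGraph.{u, v} Γ) (S : TreeAction Γ W) : Prop :=
  ∀ Y : GGraph.{u, v} Γ, Nonempty (Y.Over S) → Y.Conn → Y.Cofinite → X.complexity ≤ Y.complexity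

/-- In a graph of minimal complexity, each identification merges a trivial vertex with a vertex of
another orbit. -/
theorem IsMinimal.exists_merge (hmin : X.IsMinimal S) (F : X.Over S) (hX : X.Conn)
    (hf : X.Cofinite) {e e' : X.E} {w₁ w₂ : X.V} (D : X.MergeData e w₁ w₂)
    (D' : X.MergeData e' w₂ w₁) (hF : F.f w₁ = F.f w₂) :
    ∃ Y : GGraph.{u, v} Γ, Nonempty (Y.Over S) ∧ Y.Conn ∧ Y.Cofinite ∧
      Nat.card Y.OE < Nat.card X.OE ∧ Y.complexity ≤ X.complexity ∧
      (Y.Acyclic → X.Acyclic) ∧ ∀ A, Y.Elliptic A → X.Elliptic A := by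
  by_cases hw : orbitMk Γ w₁ = orbitMk Γ w₂ ∨ ¬ X.IsTriv w₁ ∧ ¬ X.IsTriv w₂
  · obtain ⟨Y, h1, h2, h3, h4⟩ := exists_merge_of_not_isTriv F hX hf D hF hw
    exact absurd (hmin Y h1 h2 h3) (not_le.2 h4)
  · rw [not_or, not_and_or, not_not, not_not] at hw
    obtain ⟨hw, ht | ht⟩ := hw
    · exact exists_merge_of_isTriv F hX hf D hF hw ht
    · exact exists_merge_of_isTriv F hX hf D' hF.symm (Ne.symm hw) ht

section Immersion

/-- The vertices at the end of an edge path of length `n` from `x₀`. -/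
def Reach (X : GGraph.{u, v} Γ) (x₀ : X.V) : ℕ → X.V → Prop
  | 0, y => y = x₀
  | n + 1, y => ∃ i e, X.bd (!i) e = y ∧ X.Reach x₀ n (X.bd i e)

/-- The map to the tree collapses no edge. -/
def Over.NonDegenerate (F : X.Over S) : Prop :=
  ∀ e, F.f (X.bd false e) ≠ F.f (X.bd true e)

variable {F : X.Over S} (hdeg : F.NonDegenerate)
  (hfold : ∀ i j e₁ e₂, ¬ F.IsFold i j e₁ e₂)

include hdeg in
theorem Over.dist_le_of_reach {x₀ : X.V} {n : ℕ} {y : X.V} (h : X.Reach x₀ n y) :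
    S.tree.dist (F.f x₀) (F.f y) ≤ n := by
  induction n generalizing y with
  | zero => rw [Reach] at h; rw [h, SimpleGraph.dist_self]
  | succ n ih =>
    obtain ⟨i, e, rfl, h⟩ := h
    have h1 := ih h
    have h2 := S.isTree.connected.dist_triangle (u := F.f x₀) (v := F.f (X.bd i e))
      (w := F.f (X.bd (!i) e))
    rw [SimpleGraph.dist_eq_one_iff_adj.2 (F.adj_bd (hdeg e) i)] at h2
    omega

include hdeg hfold

/-- A locally injective map lifts geodesics. -/
theorem Over.reach_dist (hX : X.Conn) (x₀ y : X.V) :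
    X.Reach x₀ (S.tree.dist (F.f x₀) (F.f y)) y := by
  have key : ∀ i e, X.Reach x₀ (S.tree.dist (F.f x₀) (F.f (X.bd i e))) (X.bd i e) →
      X.Reach x₀ (S.tree.dist (F.f x₀) (F.f (X.bd (!i) e))) (X.bd (!i) e) := by
    intro i e h
    have hadj := F.adj_bd (hdeg e) i
    rcases S.isTree.dist_eq_dist_add_one_of_adj (F.f x₀) hadj with hd | hd
    · rw [hd] at h
      obtain ⟨i', e', he', h'⟩ := h
      have hadj' := F.adj_bd (hdeg e') i'
      rw [he'] at hadj'
      have h1 := F.dist_le_of_reach hdeg h'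
      have h2 := S.isTree.eq_of_adj_of_dist_lt hadj'.symm hadj (r := F.f x₀)
        (by omega) (by omega)
      have h3 : e' = e := by
        by_contra hne
        refine hfold (!i') i e' e ⟨hne, he', by rw [Bool.not_not]; exact h2, ?_⟩
        rw [he', Bool.not_not]
        exact hadj'.symm
      subst h3
      have h4 : i' = !i := by
        by_contra h
        obtain rfl : i' = i := by cases i <;> cases i' <;> simp_all
        exact hadj.ne h2
      rw [← h4]
      rw [← h4] at hd
      convert h' using 1
      have := F.dist_le_of_reach hdeg h'
      rw [h4]
    · rw [hd]
      exact ⟨i, e, rfl, h⟩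
  refine hX.induction (P := fun y => X.Reach x₀ (S.tree.dist (F.f x₀) (F.f y)) y)
    (fun e => ⟨key false e, key true e⟩) (x := x₀) ?_ y
  rw [SimpleGraph.dist_self]
  rfl

theorem Over.injective (hX : X.Conn) : Function.Injective F.f := by
  intro x y hxy
  have := Over.reach_dist hdeg hfold hX x y
  rw [hxy, SimpleGraph.dist_self] at this
  exact Eq.symm this

/-- A connected graph mapped to a tree in a locally injective way is a subtree. -/
theorem Over.acyclic_of_not_isFold (hX : X.Conn) : X.Acyclic := by
  classical
  have hinj := Over.injective hdeg hfold hX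
  have hE : ∀ e e', s(F.f (X.bd false e), F.f (X.bd true e)) =
      s(F.f (X.bd false e'), F.f (X.bd true e')) → e = e' := by
    intro e e' h
    by_contra hne
    rcases Sym2.eq_iff.1 h with ⟨h1, h2⟩ | ⟨h1, h2⟩
    · exact hfold false false e e' ⟨hne, hinj h1, h2, F.adj_bd (hdeg e) _⟩
    · exact hfold false true e e' ⟨hne, hinj h1, h2, F.adj_bd (hdeg e) _⟩
  intro c
  obtain ⟨b, hb⟩ := S.isTree.exists_coboundary fun s =>
    if h : ∃ e, s(F.f (X.bd false e), F.f (X.bd true e)) = s then c h.choose else 0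
  refine ⟨fun v => b (F.f v), fun e => ?_⟩
  have h1 := hb _ _ (F.adj_bd (hdeg e) false)
  have h : ∃ e', s(F.f (X.bd false e'), F.f (X.bd true e')) =
    s(F.f (X.bd false e), F.f (X.bd true e)) := ⟨e, rfl⟩
  rw [Bool.not_false, dif_pos h, hE _ _ h.choose_spec] at h1
  exact h1.symm

theorem Over.elliptic_of_not_isFold (hX : X.Conn) {A : Subgroup Γ} (hA : S.IsElliptic A) :
    X.Elliptic A := by
  obtain ⟨a, ha⟩ := hA
  have hinj := Over.injective hdeg hfold hX
  obtain ⟨x₀⟩ := hX.nonempty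
  obtain ⟨_, ⟨x, rfl⟩, hx⟩ := S.isTree.exists_fixed_of_invariant (A := S.act '' A)
    (Z := Set.range F.f) ⟨_, x₀, rfl⟩ (by
      rintro _ ⟨g, -, rfl⟩ _ ⟨x, rfl⟩
      exact ⟨g • x, F.map_smul g x⟩) (by
      rintro _ ⟨x, rfl⟩ _ ⟨y, rfl⟩
      have key : ∀ i e, (∃ w : S.tree.Walk (F.f x) (F.f (X.bd i e)),
          ∀ v ∈ w.support, v ∈ Set.range F.f) → ∃ w : S.tree.Walk (F.f x) (F.f (X.bd (!i) e)),
          ∀ v ∈ w.support, v ∈ Set.range F.f := by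
        rintro i e ⟨w, hw⟩
        refine ⟨w.concat (F.adj_bd (hdeg e) i), fun v hv => ?_⟩
        rw [SimpleGraph.Walk.support_concat, List.mem_append,
          List.mem_singleton] at hv
        rcases hv with hv | rfl
        · exact hw v hv
        · exact ⟨_, rfl⟩
      refine hX.induction (P := fun y => ∃ w : S.tree.Walk (F.f x) (F.f y),
        ∀ v ∈ w.support, v ∈ Set.range F.f) (fun e => ⟨key false e, key true e⟩) (x := x)
        ⟨.nil, fun v hv => ?_⟩ y
      rw [SimpleGraph.Walk.support_nil, List.mem_singleton] at hv
      exact ⟨x, hv.symm⟩) (a := a) (by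
      rintro _ ⟨g, hg, rfl⟩
      exact ha g hg)
  exact ⟨x, fun g hg => hinj (by rw [F.map_smul]; exact hx _ ⟨g, hg, rfl⟩)⟩

end Immersion

/-- A graph of minimal complexity over a tree is itself a tree, with the same elliptic subgroups. -/
theorem IsMinimal.acyclic_and_elliptic (hmin : X.IsMinimal S) (F : X.Over S) (hX : X.Conn)
    (hf : X.Cofinite) : X.Acyclic ∧ ∀ A : Subgroup Γ, S.IsElliptic A → X.Elliptic A := by
  induction hn : Nat.card X.OE using Nat.strong_induction_on generalizing X with
  | _ n ih =>
  have step : ∀ (e e' : X.E) (w₁ w₂ : X.V), X.MergeData e w₁ w₂ → X.MergeData e' w₂ w₁ →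
      F.f w₁ = F.f w₂ → X.Acyclic ∧ ∀ A : Subgroup Γ, S.IsElliptic A → X.Elliptic A := by
    intro e e' w₁ w₂ D D' hF
    obtain ⟨Y, ⟨G⟩, hY, hYf, hcard, hc, hac, hell⟩ := hmin.exists_merge F hX hf D D' hF
    obtain ⟨h1, h2⟩ := ih _ (hn ▸ hcard) (fun Z h1 h2 h3 => hc.trans (hmin Z h1 h2 h3)) G hY hYf rfl
    exact ⟨hac h1, fun A hA => hell A (h2 A hA)⟩
  by_cases hdeg : F.NonDegenerate
  · by_cases hfold : ∀ i j e₁ e₂, ¬ F.IsFold i j e₁ e₂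
    · exact ⟨Over.acyclic_of_not_isFold hdeg hfold hX,
        fun A hA => Over.elliptic_of_not_isFold hdeg hfold hX hA⟩
    · push Not at hfold
      obtain ⟨i, j, e₁, e₂, h⟩ := hfold
      exact step _ _ _ _ h.mergeData h.symm.mergeData h.f_eq
  · simp only [Over.NonDegenerate, ne_eq, not_forall, not_not] at hdeg
    obtain ⟨e, he⟩ := hdeg
    exact step e e _ _ (mergeData_collapse e false) (mergeData_collapse e true) he

/-- A graph of minimal complexity can be modified so that no edge is collapsed in the tree. -/
theorem IsMinimal.exists_nonDegenerate (hmin : X.IsMinimal S) (F : X.Over S) (hX : X.Conn)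
    (hf : X.Cofinite) : ∃ (Y : GGraph.{u, v} Γ) (G : Y.Over S), Y.Conn ∧ Y.Cofinite ∧
      G.NonDegenerate ∧ Y.complexity ≤ X.complexity := by
  induction hn : Nat.card X.OE using Nat.strong_induction_on generalizing X with
  | _ n ih =>
  by_cases hdeg : F.NonDegenerate
  · exact ⟨X, F, hX, hf, hdeg, le_rfl⟩
  · simp only [Over.NonDegenerate, ne_eq, not_forall, not_not] at hdeg
    obtain ⟨e, he⟩ := hdeg
    obtain ⟨Y, ⟨G⟩, hY, hYf, hcard, hc, -, -⟩ := hmin.exists_merge F hX hf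
      (mergeData_collapse e false) (mergeData_collapse e true) he
    obtain ⟨Z, K, h1, h2, h3, h4⟩ :=
      ih _ (hn ▸ hcard) (fun Z h1 h2 h3 => hc.trans (hmin Z h1 h2 h3)) G hY hYf rfl
    exact ⟨Z, K, h1, h2, h3, h4.trans hc⟩

end GGraph

namespace GGraph

variable {Γ : Type u} [Group Γ] {X : GGraph.{u, v} Γ}

/-! ### Quotients by normal subgroups -/

section NormalQuotient

variable (K : Subgroup Γ) [K.Normal] {A : Type*} [MulAction Γ A]

/-- The space of orbits of a normal subgroup `K`, with the action of the ambient group. -/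
def KQuot (K : Subgroup Γ) (A : Type*) [MulAction Γ A] : Type _ :=
  Quot fun x y : A => ∃ k ∈ K, k • x = y

instance : MulAction Γ (KQuot K A) :=
  quotAction _ (by
    rintro g x _ ⟨k, hk, rfl⟩
    exact ⟨g * k * g⁻¹, Subgroup.Normal.conj_mem inferInstance k hk g, by
      rw [mul_smul, inv_smul_smul, mul_smul]⟩)

/-- The projection to the space of orbits of `K`. -/
def kMk (K : Subgroup Γ) {A : Type*} [MulAction Γ A] (x : A) : KQuot K A := Quot.mk _ x

theorem kMk_smul (g : Γ) (x : A) : kMk K (g • x) = g • kMk K x := rfl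

omit [K.Normal] in
theorem kMk_surjective : Function.Surjective (kMk K : A → _) := Quot.mk_surjective

omit [K.Normal] in
theorem kMk_eq_iff {x y : A} : kMk K x = kMk K y ↔ ∃ k ∈ K, k • x = y := by
  refine Equivalence.quot_mk_eq_iff ⟨fun x => ⟨1, K.one_mem, one_smul _ _⟩, ?_, ?_⟩ x y
  · rintro x _ ⟨k, hk, rfl⟩
    exact ⟨k⁻¹, K.inv_mem hk, inv_smul_smul _ _⟩
  · rintro x _ _ ⟨k, hk, rfl⟩ ⟨k', hk', rfl⟩
    exact ⟨k' * k, K.mul_mem hk' hk, mul_smul _ _ _⟩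

theorem smul_kMk_eq_iff {g : Γ} {x y : A} : g • kMk K x = kMk K y ↔ ∃ k ∈ K, (k * g) • x = y := by
  rw [← kMk_smul, kMk_eq_iff]
  simp only [mul_smul]

/-- The quotient of a graph by a normal subgroup. -/
def quot (X : GGraph.{u, v} Γ) : GGraph.{u, v} Γ where
  V := KQuot K X.V
  E := KQuot K X.E
  bd i := Quot.map (X.bd i) (by
    rintro e _ ⟨k, hk, rfl⟩
    exact ⟨k, hk, (X.bd_smul i k e).symm⟩)
  bd_smul i g := by
    rintro ⟨e⟩
    exact congrArg _ (X.bd_smul i g e)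

theorem Conn.quot (hX : X.Conn) : (X.quot K).Conn where
  nonempty := hX.nonempty.map (kMk K)
  eq_of_cobd b hb x y := by
    obtain ⟨x, rfl⟩ := kMk_surjective K x
    obtain ⟨y, rfl⟩ := kMk_surjective K y
    exact hX.eq_of_cobd (fun v => b (kMk K v)) (fun e => hb (kMk K e)) x y

/-- The map induced on orbit spaces. -/
def orbitKMk (A : Type*) [MulAction Γ A] :
    MulAction.orbitRel.Quotient Γ A → MulAction.orbitRel.Quotient Γ (KQuot K A) :=
  orbitMap (fun x => orbitMk Γ (kMk K x)) fun g x => orbitMk_smul g (kMk K x)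

theorem orbitKMk_bijective : Function.Bijective (orbitKMk K A) := by
  constructor
  · intro o o' h
    obtain ⟨x, rfl⟩ := orbitMk_surjective o
    obtain ⟨y, rfl⟩ := orbitMk_surjective o'
    obtain ⟨g, hg⟩ := orbitMk_eq_iff.1 h
    obtain ⟨k, -, hk⟩ := (smul_kMk_eq_iff K).1 hg
    exact orbitMk_eq_iff.2 ⟨k * g, hk⟩
  · intro o
    obtain ⟨x, rfl⟩ := orbitMk_surjective o
    obtain ⟨x, rfl⟩ := kMk_surjective K x
    exact ⟨orbitMk Γ x, rfl⟩

theorem Cofinite.quot (hf : X.Cofinite) : (X.quot K).Cofinite where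
  finV := have := hf.finV; Finite.of_surjective _ (orbitKMk_bijective K (A := X.V)).2
  finE := have := hf.finE; Finite.of_surjective _ (orbitKMk_bijective K (A := X.E)).2

theorem IsTriv.quot {x : X.V} (hx : X.IsTriv x) : (X.quot K).IsTriv (kMk K x) := by
  intro i e he g hg
  obtain ⟨e, rfl⟩ := kMk_surjective K e
  obtain ⟨k, hk, hke⟩ := (kMk_eq_iff K).1 he
  obtain ⟨k', hk', hkg⟩ := (smul_kMk_eq_iff K).1 hg
  have h1 := hx i (k • e) (by rw [X.bd_smul, hke]) (k' * g) hkg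
  have h2 : kMk K e = kMk K (k • e) := (kMk_eq_iff K).2 ⟨k, hk, rfl⟩
  rw [h2]
  exact (smul_kMk_eq_iff K).2 ⟨k', hk', h1⟩

theorem complexity_quot_le (hf : X.Cofinite) : (X.quot K).complexity ≤ X.complexity := by
  have h1 : Nat.card X.OE = Nat.card (X.quot K).OE :=
    Nat.card_eq_of_bijective _ (orbitKMk_bijective K (A := X.E))
  have h2 : Nat.card X.OV = Nat.card (X.quot K).OV :=
    Nat.card_eq_of_bijective _ (orbitKMk_bijective K (A := X.V))
  have h3 : X.trivOrbits.ncard ≤ (X.quot K).trivOrbits.ncard := by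
    have := (hf.quot K).finV
    refine Set.ncard_le_ncard_of_injOn (orbitKMk K X.V) ?_
      ((orbitKMk_bijective K (A := X.V)).1.injOn)
    rintro _ ⟨x, hx, rfl⟩
    exact ⟨_, hx.quot K, rfl⟩
  rw [complexity, complexity]
  omega

end NormalQuotient

/-! ### Subdivision -/

section SumOrbits

variable {A B : Type*} [MulAction Γ A] [MulAction Γ B]

/-- The orbits of a disjoint union. -/
def orbitSumEquiv : MulAction.orbitRel.Quotient Γ (A ⊕ B) ≃
    MulAction.orbitRel.Quotient Γ A ⊕ MulAction.orbitRel.Quotient Γ B where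
  toFun := orbitMap (Sum.map (orbitMk Γ) (orbitMk Γ)) (by
    rintro g (x | x)
    · exact congrArg Sum.inl (orbitMk_smul g x)
    · exact congrArg Sum.inr (orbitMk_smul g x))
  invFun := Sum.elim
    (orbitMap (fun x => orbitMk Γ (Sum.inl x)) fun g x => orbitMk_smul g (Sum.inl x))
    (orbitMap (fun x => orbitMk Γ (Sum.inr x)) fun g x => orbitMk_smul g (Sum.inr x))
  left_inv o := by
    obtain ⟨x | x, rfl⟩ := orbitMk_surjective o <;> rfl
  right_inv o := by
    rcases o with o | o
    · obtain ⟨x, rfl⟩ := orbitMk_surjective o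
      rfl
    · obtain ⟨x, rfl⟩ := orbitMk_surjective o
      rfl

end SumOrbits

variable {W : Type*} {S : TreeAction Γ W}

/-- An equivariant map from a graph to a tree sending each edge to a geodesic, in such a way that
the stabilizers of the edges of this geodesic fix the edge. -/
structure PathOver (X : GGraph.{u, v} Γ) {W : Type*} (S : TreeAction Γ W) where
  /-- The map on vertices. -/
  f : X.V → W
  map_smul : ∀ (g : Γ) x, f (g • x) = S.act g (f x)
  stab : ∀ e c d, S.tree.EdgeSeparates c d (f (X.bd false e)) (f (X.bd true e)) → ∀ g : Γ,
    S.act g c = c → S.act g d = d → g • e = e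

namespace PathOver

variable (F : X.PathOver S)

/-- The image of an edge. -/
noncomputable def geo (e : X.E) : S.tree.Walk (F.f (X.bd false e)) (F.f (X.bd true e)) :=
  S.isTree.geodesic _ _

/-- The number of edges into which an edge is subdivided; this is `1` for a degenerate edge. -/
noncomputable def len (e : X.E) : ℕ := max 1 (F.geo e).length

theorem one_le_len (e : X.E) : 1 ≤ F.len e := le_max_left _ _

theorem getVert_geo_smul (g : Γ) (e : X.E) (j : ℕ) :
    (F.geo (g • e)).getVert j = S.act g ((F.geo e).getVert j) := by
  rw [geo, X.bd_smul, X.bd_smul, F.map_smul, F.map_smul]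
  exact S.isTree.getVert_geodesic_map (S.act g) _ _ j

theorem len_smul (g : Γ) (e : X.E) : F.len (g • e) = F.len e := by
  have : (F.geo (g • e)).length = (F.geo e).length := by
    rw [geo, X.bd_smul, X.bd_smul, F.map_smul, F.map_smul]
    exact S.isTree.length_geodesic_map (S.act g) _ _
  rw [len, len, this]

/-- The interior vertices of the subdivided edges: `(e, i)` is the vertex number `i + 1` of `e`. -/
def Interior : Type v := {p : X.E × ℕ // p.2 + 1 < F.len p.1}

instance : MulAction Γ F.Interior where
  smul g p := ⟨(g • p.1.1, p.1.2), by rw [F.len_smul]; exact p.2⟩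
  one_smul p := Subtype.ext (Prod.ext (one_smul Γ p.1.1) rfl)
  mul_smul g h p := Subtype.ext (Prod.ext (mul_smul g h p.1.1) rfl)

open Classical in
/-- The vertex number `j` of the subdivided edge `e`. -/
noncomputable def pt (e : X.E) (j : ℕ) : X.V ⊕ F.Interior :=
  if j = 0 then Sum.inl (X.bd false e) else
  if h : j - 1 + 1 < F.len e then Sum.inr ⟨(e, j - 1), h⟩ else Sum.inl (X.bd true e)

theorem pt_zero (e : X.E) : F.pt e 0 = Sum.inl (X.bd false e) := if_pos rfl

theorem pt_len (e : X.E) : F.pt e (F.len e) = Sum.inl (X.bd true e) := by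
  have := F.one_le_len e
  rw [pt, if_neg (by omega), dif_neg (by omega)]

theorem pt_interior (p : F.Interior) : F.pt p.1.1 (p.1.2 + 1) = Sum.inr p := by
  rw [pt, if_neg (by omega)]
  exact dif_pos p.2

theorem pt_cases (e : X.E) (j : ℕ) : F.pt e j = Sum.inl (X.bd false e) ∨
    F.pt e j = Sum.inl (X.bd true e) ∨ ∃ p : F.Interior, p.1.1 = e ∧ F.pt e j = Sum.inr p := by
  rw [pt]
  split_ifs with h1 h2
  · exact Or.inl rfl
  · exact Or.inr (Or.inr ⟨_, rfl, rfl⟩)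
  · exact Or.inr (Or.inl rfl)

theorem pt_smul (g : Γ) (e : X.E) (j : ℕ) : F.pt (g • e) j = g • F.pt e j := by
  simp only [pt, F.len_smul, X.bd_smul]
  split_ifs <;> rfl

/-- The edge of the given graph that contains an edge of the subdivision. -/
def base : X.E ⊕ F.Interior → X.E := Sum.elim id fun p => p.1.1

/-- The position of an edge of the subdivision in the edge that contains it. -/
def idx : X.E ⊕ F.Interior → ℕ := Sum.elim (fun _ => 0) fun p => p.1.2 + 1

theorem exists_base_idx (e : X.E) {j : ℕ} (hj : j < F.len e) :
    ∃ a, F.base a = e ∧ F.idx a = j := by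
  rcases j with _ | j
  · exact ⟨Sum.inl e, rfl, rfl⟩
  · exact ⟨Sum.inr ⟨(e, j), hj⟩, rfl, rfl⟩

theorem base_smul (g : Γ) (a : X.E ⊕ F.Interior) : F.base (g • a) = g • F.base a := by
  rcases a with e | p <;> rfl

theorem idx_smul (g : Γ) (a : X.E ⊕ F.Interior) : F.idx (g • a) = F.idx a := by
  rcases a with e | p <;> rfl

theorem smul_eq_of_base {g : Γ} {a : X.E ⊕ F.Interior} (h : g • F.base a = F.base a) :
    g • a = a := by
  rcases a with e | p
  · exact congrArg Sum.inl h
  · exact congrArg Sum.inr (Subtype.ext (Prod.ext h rfl))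

/-- The graph obtained by subdividing each edge according to its image in the tree. -/
noncomputable def subdiv : GGraph.{u, v} Γ where
  V := X.V ⊕ F.Interior
  E := X.E ⊕ F.Interior
  bd i a := F.pt (F.base a) (F.idx a + i.toNat)
  bd_smul i g a := by rw [base_smul, idx_smul, pt_smul]

theorem subdiv_bd (i : Bool) (a : X.E ⊕ F.Interior) :
    F.subdiv.bd i a = F.pt (F.base a) (F.idx a + i.toNat) := rfl

/-- The map from the subdivision to the tree, on vertices. -/
noncomputable def subdivMap : X.V ⊕ F.Interior → W :=
  Sum.elim F.f fun p => (F.geo p.1.1).getVert (p.1.2 + 1)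

theorem subdivMap_pt (e : X.E) {j : ℕ} : F.subdivMap (F.pt e j) = (F.geo e).getVert j := by
  have h : (F.geo e).length ≤ F.len e := le_max_right _ _
  rw [pt]
  split_ifs with h1 h2
  · rw [h1, SimpleGraph.Walk.getVert_zero]; rfl
  · change (F.geo e).getVert (j - 1 + 1) = _
    rw [Nat.sub_add_cancel (by omega)]
  · rw [SimpleGraph.Walk.getVert_of_length_le _ (by omega)]; rfl

/-- The subdivision maps simplicially to the tree. -/
noncomputable def subdivOver : F.subdiv.Over S where
  f := F.subdivMap
  map_smul := by
    rintro g (x | p)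
    · exact F.map_smul g x
    · exact F.getVert_geo_smul g p.1.1 _
  adj a := by
    change F.subdivMap (F.pt (F.base a) (F.idx a)) = F.subdivMap (F.pt (F.base a) (F.idx a + 1)) ∨
      S.tree.Adj (F.subdivMap (F.pt (F.base a) (F.idx a)))
        (F.subdivMap (F.pt (F.base a) (F.idx a + 1)))
    rw [F.subdivMap_pt, F.subdivMap_pt]
    by_cases h : F.idx a < (F.geo (F.base a)).length
    · exact Or.inr ((F.geo _).adj_getVert_succ h)
    · rw [SimpleGraph.Walk.getVert_of_length_le _ (not_lt.1 h),
        SimpleGraph.Walk.getVert_of_length_le _ ((not_lt.1 h).trans (Nat.le_add_right _ _))]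
      exact Or.inl rfl
  stab a hadj g h1 h2 := by
    change S.tree.Adj (F.subdivMap (F.pt (F.base a) (F.idx a)))
        (F.subdivMap (F.pt (F.base a) (F.idx a + 1))) at hadj
    change S.act g (F.subdivMap (F.pt (F.base a) (F.idx a))) =
      F.subdivMap (F.pt (F.base a) (F.idx a)) at h1
    change S.act g (F.subdivMap (F.pt (F.base a) (F.idx a + 1))) =
      F.subdivMap (F.pt (F.base a) (F.idx a + 1)) at h2
    rw [F.subdivMap_pt] at h1 h2
    rw [F.subdivMap_pt, F.subdivMap_pt] at hadj
    have h : F.idx a < (F.geo (F.base a)).length := by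
      by_contra h
      rw [SimpleGraph.Walk.getVert_of_length_le _ (not_lt.1 h),
        SimpleGraph.Walk.getVert_of_length_le _ ((not_lt.1 h).trans (Nat.le_add_right _ _))] at hadj
      exact hadj.ne rfl
    exact F.smul_eq_of_base (F.stab _ _ _ (S.isTree.edgeSeparates_getVert _ _ h) g h1 h2)

theorem conn_subdiv (hX : X.Conn) : F.subdiv.Conn where
  nonempty := hX.nonempty.map Sum.inl
  eq_of_cobd b hb := by
    have hstep : ∀ e j, j ≤ F.len e → b (F.pt e j) = b (F.pt e 0) := by
      intro e j
      induction j with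
      | zero => exact fun _ => rfl
      | succ j ih =>
        intro hj
        obtain ⟨a, rfl, rfl⟩ := F.exists_base_idx e (Nat.lt_of_succ_le hj)
        rw [← ih (by omega)]
        exact ((F.subdiv.cobd_eq_zero_iff b a).1 (hb a)).symm
    have hinl : ∀ x y, b (Sum.inl x) = b (Sum.inl y) := by
      refine hX.eq_of_cobd (fun v => b (Sum.inl v)) fun e => ?_
      rw [X.cobd_eq_zero_iff, ← F.pt_zero, ← F.pt_len]
      exact (hstep e _ le_rfl).symm
    have hall : ∀ x, ∃ y, b x = b (Sum.inl y) := by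
      rintro (x | p)
      · exact ⟨x, rfl⟩
      · refine ⟨X.bd false p.1.1, ?_⟩
        rw [← F.pt_interior, ← F.pt_zero]
        exact hstep _ _ (by have := p.2; omega)
    intro x y
    obtain ⟨x', hx⟩ := hall x
    obtain ⟨y', hy⟩ := hall y
    rw [hx, hy, hinl x' y']

theorem finite_orbits_interior (hf : X.Cofinite) :
    Finite (MulAction.orbitRel.Quotient Γ F.Interior) := by
  have := hf.finE
  obtain ⟨N, hN⟩ := (Set.finite_range (orbitMap F.len F.len_smul)).bddAbove
  have hN' : ∀ e, F.len e ≤ N := fun e => hN ⟨orbitMk Γ e, rfl⟩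
  let h : F.Interior → X.OE × Fin N := fun p =>
    (orbitMk Γ p.1.1, ⟨p.1.2, by have := p.2; have := hN' p.1.1; omega⟩)
  refine Finite.of_injective (β := X.OE × Fin N) (orbitMap h fun g p =>
    Prod.ext (orbitMk_smul g p.1.1) rfl) ?_
  intro o o' hoo
  obtain ⟨p, rfl⟩ := orbitMk_surjective o
  obtain ⟨p', rfl⟩ := orbitMk_surjective o'
  obtain ⟨h1, h2⟩ := Prod.ext_iff.1 hoo
  obtain ⟨g, hg⟩ := orbitMk_eq_iff.1 h1
  exact orbitMk_eq_iff.2 ⟨g, Subtype.ext (Prod.ext hg (congrArg Fin.val h2).symm)⟩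

theorem cofinite_subdiv (hf : X.Cofinite) : F.subdiv.Cofinite where
  finV := by
    have := hf.finV
    have := F.finite_orbits_interior hf
    exact Finite.of_equiv _ (orbitSumEquiv (Γ := Γ) (A := X.V) (B := F.Interior)).symm
  finE := by
    have := hf.finE
    have := F.finite_orbits_interior hf
    exact Finite.of_equiv _ (orbitSumEquiv (Γ := Γ) (A := X.E) (B := F.Interior)).symm

theorem isTriv_inl {x : X.V} (hx : X.IsTriv x) : F.subdiv.IsTriv (Sum.inl x) := by
  intro i a ha g hg
  apply F.smul_eq_of_base
  have hg' : g • x = x := Sum.inl_injective hg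
  replace ha : F.pt (F.base a) (F.idx a + i.toNat) = _ := ha
  rcases F.pt_cases (F.base a) (F.idx a + i.toNat) with h | h | ⟨p, -, h⟩
  · exact hx false _ (Sum.inl_injective (h.symm.trans ha)) g hg'
  · exact hx true _ (Sum.inl_injective (h.symm.trans ha)) g hg'
  · exact absurd (h.symm.trans ha) Sum.inr_ne_inl

theorem isTriv_inr (p : F.Interior) : F.subdiv.IsTriv (Sum.inr p) := by
  intro i a ha g hg
  apply F.smul_eq_of_base
  have hg' : g • p.1.1 = p.1.1 := congrArg (fun p => p.1.1) (Sum.inr_injective hg)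
  replace ha : F.pt (F.base a) (F.idx a + i.toNat) = _ := ha
  rcases F.pt_cases (F.base a) (F.idx a + i.toNat) with h | h | ⟨p', hp, h⟩
  · exact absurd (h.symm.trans ha) Sum.inl_ne_inr
  · exact absurd (h.symm.trans ha) Sum.inl_ne_inr
  · rw [← hp, Sum.inr_injective (h.symm.trans ha), hg']

theorem complexity_subdiv_le (hf : X.Cofinite) : F.subdiv.complexity ≤ X.complexity := by
  have := hf.finV
  have := hf.finE
  have := F.finite_orbits_interior hf
  have hfin := (F.cofinite_subdiv hf).finV
  have h1 : Nat.card F.subdiv.OE =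
      Nat.card X.OE + Nat.card (MulAction.orbitRel.Quotient Γ F.Interior) := by
    rw [← Nat.card_sum]
    exact Nat.card_congr (orbitSumEquiv (Γ := Γ) (A := X.E) (B := F.Interior))
  have h2 : Nat.card F.subdiv.OV =
      Nat.card X.OV + Nat.card (MulAction.orbitRel.Quotient Γ F.Interior) := by
    rw [← Nat.card_sum]
    exact Nat.card_congr (orbitSumEquiv (Γ := Γ) (A := X.V) (B := F.Interior))
  have h3 : X.trivOrbits.ncard + Nat.card (MulAction.orbitRel.Quotient Γ F.Interior) ≤
      F.subdiv.trivOrbits.ncard := by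
    let ε := (orbitSumEquiv (Γ := Γ) (A := X.V) (B := F.Interior)).symm
    have hsub : ε '' (Sum.inl '' X.trivOrbits ∪ Sum.inr '' Set.univ) ⊆ F.subdiv.trivOrbits := by
      rintro _ ⟨_, ⟨_, ⟨x, hx, rfl⟩, rfl⟩ | ⟨o, -, rfl⟩, rfl⟩
      · exact ⟨_, F.isTriv_inl hx, rfl⟩
      · obtain ⟨p, rfl⟩ := orbitMk_surjective o
        exact ⟨_, F.isTriv_inr p, rfl⟩
    have h4 := Set.ncard_le_ncard hsub (@Set.toFinite F.subdiv.OV _ (@Subtype.finite _ hfin _))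
    rw [Set.ncard_image_of_injective _ ε.injective, Set.ncard_union_eq (by
        rw [Set.disjoint_left]
        rintro _ ⟨x, -, rfl⟩ ⟨y, -, h⟩
        exact Sum.inr_ne_inl h) (Set.toFinite _) (Set.toFinite _),
      Set.ncard_image_of_injective _ Sum.inl_injective,
      Set.ncard_image_of_injective _ Sum.inr_injective, Set.ncard_univ] at h4
    exact h4
  rw [complexity, complexity]
  omega

theorem acyclic_of_subdiv (h : F.subdiv.Acyclic) : X.Acyclic := by
  intro c
  obtain ⟨b, hb⟩ := h (Sum.elim c fun _ => 0)
  have hstep : ∀ e j, 1 ≤ j → j ≤ F.len e → b (F.pt e j) = b (F.pt e 1) := by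
    intro e j h1
    induction j, h1 using Nat.le_induction with
    | base => exact fun _ => rfl
    | succ j hj ih =>
      intro hj'
      rw [← ih (by omega)]
      obtain ⟨a, ha1, ha2⟩ := F.exists_base_idx e (Nat.lt_of_succ_le hj')
      rcases a with e' | p
      · have : 0 = j := ha2
        omega
      · have h0 := hb (Sum.inr p)
        have h1 := (F.subdiv.cobd_eq_zero_iff b _).1 h0
        rw [subdiv_bd, subdiv_bd, ha1, ha2] at h1
        exact h1.symm
  refine ⟨fun v => b (Sum.inl v), fun e => ?_⟩
  have h0 : b (F.pt e 0) + b (F.pt e 1) = c e := hb (Sum.inl e)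
  rw [← hstep e _ (F.one_le_len e) le_rfl, F.pt_zero, F.pt_len] at h0
  exact h0

theorem elliptic_of_subdiv {A : Subgroup Γ} (h : F.subdiv.Elliptic A) : X.Elliptic A := by
  obtain ⟨x | p, hx⟩ := h
  · exact ⟨x, fun g hg => Sum.inl_injective (hx g hg)⟩
  · refine ⟨X.bd false p.1.1, fun g hg => ?_⟩
    have h1 : g • p = p := Sum.inr_injective (hx g hg)
    have h2 : g • p.1.1 = p.1.1 := congrArg (fun p : F.Interior => p.1.1) h1
    rw [← X.bd_smul, h2]

end PathOver

/-- Let `X` be a graph whose complexity is at most that of any connected cofinite graph over `S'`.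
If some quotient of `X` maps to `S'` as in `PathOver`, then this quotient is a tree in which each
elliptic subgroup of `S'` is elliptic. -/
theorem quot_acyclic_and_elliptic {W' : Type*} {S' : TreeAction Γ W'}
    (hX : X.Conn) (hf : X.Cofinite) (K : Subgroup Γ) [K.Normal]
    (F' : (X.quot K).PathOver S')
    (hmin : ∀ Y : GGraph.{u, v} Γ, Nonempty (Y.Over S') → Y.Conn → Y.Cofinite →
      X.complexity ≤ Y.complexity) :
    (X.quot K).Acyclic ∧ ∀ A : Subgroup Γ, S'.IsElliptic A → (X.quot K).Elliptic A := by
  have hmin' : F'.subdiv.IsMinimal S' := fun Y h1 h2 h3 =>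
    ((F'.complexity_subdiv_le (hf.quot K)).trans (complexity_quot_le K hf)).trans (hmin Y h1 h2 h3)
  obtain ⟨h1, h2⟩ := hmin'.acyclic_and_elliptic F'.subdivOver (F'.conn_subdiv (hX.quot K))
    (F'.cofinite_subdiv (hf.quot K))
  exact ⟨F'.acyclic_of_subdiv h1, fun A hA => F'.elliptic_of_subdiv (h2 A hA)⟩

end GGraph

/-! ### From acyclic graphs to trees -/

namespace GGraph

variable {Γ : Type u} [Group Γ] {X : GGraph.{u, v} Γ}

theorem Acyclic.bd_ne (ha : X.Acyclic) (i : Bool) (e : X.E) : X.bd i e ≠ X.bd (!i) e := by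
  intro h
  obtain ⟨b, hb⟩ := ha fun _ => 1
  have := hb e
  rw [X.cobd_eq b i, h, CharTwo.add_self_eq_zero] at this
  exact zero_ne_one this

theorem Acyclic.eq_of_bd_eq (ha : X.Acyclic) {i j : Bool} {e e' : X.E}
    (h1 : X.bd i e = X.bd j e') (h2 : X.bd (!i) e = X.bd (!j) e') : e = e' := by
  classical
  by_contra hne
  obtain ⟨b, hb⟩ := ha fun e' => if e' = e then 1 else 0
  have h3 := hb e
  have h4 := hb e'
  rw [if_pos rfl, X.cobd_eq b i, h1, h2, ← X.cobd_eq b j, h4, if_neg (Ne.symm hne)] at h3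
  exact zero_ne_one h3

/-- The simple graph associated with an acyclic graph. -/
def simpleGraph (ha : X.Acyclic) : SimpleGraph X.V where
  Adj a b := ∃ i e, X.bd i e = a ∧ X.bd (!i) e = b
  symm := ⟨by
    rintro a b ⟨i, e, h1, h2⟩
    exact ⟨!i, e, h2, by rw [Bool.not_not]; exact h1⟩⟩
  loopless := ⟨by
    rintro a ⟨i, e, h1, h2⟩
    exact ha.bd_ne i e (h1.trans h2.symm)⟩

theorem isTree_simpleGraph (hX : X.Conn) (ha : X.Acyclic) : (simpleGraph ha).IsTree := by
  have := hX.nonempty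
  refine ⟨⟨fun x y => ?_⟩, ?_⟩
  · have key : ∀ i e, (simpleGraph ha).Reachable x (X.bd i e) →
        (simpleGraph ha).Reachable x (X.bd (!i) e) := fun i e h =>
      h.trans (SimpleGraph.Adj.reachable ⟨i, e, rfl, rfl⟩)
    exact hX.induction (P := fun y => (simpleGraph ha).Reachable x y)
      (fun e => ⟨key false e, key true e⟩) (SimpleGraph.Reachable.refl x) y
  · classical
    rw [SimpleGraph.isAcyclic_iff_forall_adj_isBridge]
    rintro _ _ ⟨i, e, rfl, rfl⟩
    rw [SimpleGraph.isBridge_iff]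
    -- A cochain whose coboundary is supported on `e` separates the two sides of `e`.
    obtain ⟨b, hb⟩ := ha fun e' => if e' = e then 1 else 0
    have hwalk : ∀ x y, ((simpleGraph ha).deleteEdges {s(X.bd i e, X.bd (!i) e)}).Walk x y →
        b x = b y := by
      intro x y w
      induction w with
      | nil => rfl
      | @cons x z y h p ih =>
        rw [← ih]
        rw [SimpleGraph.deleteEdges_adj] at h
        obtain ⟨⟨j, e', rfl, rfl⟩, h⟩ := h
        have hne : e' ≠ e := by
          rintro rfl
          apply h
          rw [Set.mem_singleton_iff]
          cases i <;> cases j <;> simp [Sym2.eq_swap]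
        have h1 := hb e'
        rw [if_neg hne, X.cobd_eq b j] at h1
        exact CharTwo.add_eq_zero.1 h1
    rintro ⟨w⟩
    have h1 := hb e
    rw [if_pos rfl, X.cobd_eq b i, hwalk _ _ w, CharTwo.add_self_eq_zero] at h1
    exact zero_ne_one h1

/-- The action on the tree associated with a connected acyclic graph. -/
def toTreeAction (hX : X.Conn) (ha : X.Acyclic) : TreeAction Γ X.V where
  tree := simpleGraph ha
  isTree := isTree_simpleGraph hX ha
  act :=
    { toFun := fun g =>
        { toEquiv := MulAction.toPerm g
          map_rel_iff' := by
            have key : ∀ (g : Γ) a b, (simpleGraph ha).Adj a b →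
                (simpleGraph ha).Adj (g • a) (g • b) := by
              rintro g _ _ ⟨i, e, rfl, rfl⟩
              exact ⟨i, g • e, X.bd_smul _ _ _, X.bd_smul _ _ _⟩
            intro a b
            refine ⟨fun h => ?_, key g a b⟩
            have := key g⁻¹ _ _ h
            simpa using this }
      map_one' := by
        ext a
        exact one_smul Γ a
      map_mul' := fun g h => by
        ext a
        exact mul_smul g h a }
  noInversion := by
    rintro g _ _ ⟨i, e, rfl, rfl⟩ ⟨h1, h2⟩
    replace h1 : g • X.bd i e = X.bd (!i) e := h1
    replace h2 : g • X.bd (!i) e = X.bd i e := h2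
    have h3 : g • e = e := ha.eq_of_bd_eq (i := i) (j := !i) (by rw [X.bd_smul, h1])
      (by rw [X.bd_smul, h2, Bool.not_not])
    rw [← X.bd_smul, h3] at h1
    exact ha.bd_ne i e h1

theorem exists_edge_fixed (hX : X.Conn) (ha : X.Acyclic) {x y : X.V} (hxy : x ≠ y) :
    ∃ e : X.E, ∀ g : Γ, g • x = x → g • y = y → g • e = e := by
  obtain ⟨z, ⟨i, e, rfl, rfl⟩, h⟩ := (isTree_simpleGraph hX ha).exists_adj_fixed hxy
  refine ⟨e, fun g hx hy => ?_⟩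
  have hz : g • X.bd (!i) e = X.bd (!i) e := h ((X.toTreeAction hX ha).act g) hx hy
  exact ha.eq_of_bd_eq (i := i) (j := i) (by rw [X.bd_smul, hx]) (by rw [X.bd_smul, hz])

end GGraph

/-! ### Sequences of trees -/

/-- A sequence of trees with actions of the same group `Γ`. The action on the tree number `n` is
seen as an action of `Γ / K n`, and the maps between consecutive trees do not increase the edge
stabilizers. -/
structure TreeSequence (Γ : Type u) [Group Γ] (W : ℕ → Type v) where
  /-- The trees. -/
  S : ∀ n, TreeAction Γ (W n)
  /-- A normal subgroup acting trivially on the tree. -/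
  K : ℕ → Subgroup Γ
  normal : ∀ n, (K n).Normal
  mono : Monotone K
  act_eq : ∀ n, ∀ k ∈ K n, ∀ x, (S n).act k x = x
  /-- The maps between the trees. -/
  f : ∀ n, W n → W (n + 1)
  map_act : ∀ n g x, f n ((S n).act g x) = (S (n + 1)).act g (f n x)
  stab : ∀ n a b, (S n).tree.Adj a b → ∀ c d,
    (S (n + 1)).tree.EdgeSeparates c d (f n a) (f n b) → ∀ g : Γ,
    (S (n + 1)).act g c = c → (S (n + 1)).act g d = d →
    ∃ h : Γ, (S n).act h a = a ∧ (S n).act h b = b ∧ h⁻¹ * g ∈ K (n + 1)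

namespace TreeSequence

variable {Γ : Type u} [Group Γ] {W : ℕ → Type v} (T : TreeSequence Γ W)

attribute [instance] TreeSequence.normal

/-- The composite maps between the trees do not increase the edge stabilizers. -/
theorem exists_map {m n : ℕ} (hmn : m ≤ n) : ∃ φ : W m → W n,
    (∀ g x, φ ((T.S m).act g x) = (T.S n).act g (φ x)) ∧
    ∀ a b, (T.S m).tree.Adj a b → ∀ c d, (T.S n).tree.EdgeSeparates c d (φ a) (φ b) → ∀ g : Γ,
      (T.S n).act g c = c → (T.S n).act g d = d →
      ∃ h : Γ, (T.S m).act h a = a ∧ (T.S m).act h b = b ∧ h⁻¹ * g ∈ T.K n := by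
  induction n, hmn using Nat.le_induction with
  | base =>
    refine ⟨id, fun _ _ => rfl, fun a b hab c d hs g hc hd => ⟨g, ?_⟩⟩
    have := hs (.cons hab .nil)
    rw [SimpleGraph.Walk.edges_cons, SimpleGraph.Walk.edges_nil, List.mem_singleton,
      Sym2.eq_iff] at this
    rcases this with ⟨rfl, rfl⟩ | ⟨rfl, rfl⟩
    · exact ⟨hc, hd, by simp [T.K m |>.one_mem]⟩
    · exact ⟨hd, hc, by simp [T.K m |>.one_mem]⟩
  | succ n hmn ih =>
    obtain ⟨φ, hφ, hst⟩ := ih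
    refine ⟨fun x => T.f n (φ x), fun g x =>
      (congrArg _ (hφ g x)).trans (T.map_act _ _ _), ?_⟩
    intro a b hab c d hs g hc hd
    have hp := (T.S n).isTree.geodesic_isPath (φ a) (φ b)
    obtain ⟨x, y, hxy, hmem, hs'⟩ :=
      ((T.S n).isTree.geodesic (φ a) (φ b)).exists_edgeSeparates (T.f n) hs
    obtain ⟨h, hx, hy, hk⟩ := T.stab n x y hxy c d hs' g hc hd
    obtain ⟨h', ha, hb, hk'⟩ := hst a b hab x y
      ((T.S n).isTree.isAcyclic.edgeSeparates_of_mem_edges hp hmem) h hx hy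
    refine ⟨h', ha, hb, ?_⟩
    have := (T.K (n + 1)).mul_mem (T.mono n.le_succ hk') hk
    rwa [mul_assoc, mul_inv_cancel_left] at this

theorem isElliptic_mono {m n : ℕ} (hmn : m ≤ n) {A : Subgroup Γ} (hA : (T.S m).IsElliptic A) :
    (T.S n).IsElliptic A := by
  obtain ⟨a, ha⟩ := hA
  obtain ⟨φ, hφ, -⟩ := T.exists_map hmn
  exact ⟨φ a, fun g hg => by rw [← hφ, ha g hg]⟩

/-- The quotient by `K n` of a graph over the tree number `m` maps to the tree number `n`. -/
theorem nonempty_pathOver {m n : ℕ} (hmn : m ≤ n) {X : GGraph.{u, v} Γ} (F : X.Over (T.S m)) :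
    Nonempty ((X.quot (T.K n)).PathOver (T.S n)) := by
  obtain ⟨φ, hφ, hst⟩ := T.exists_map hmn
  refine ⟨⟨Quot.lift (fun x => φ (F.f x)) ?_, ?_, ?_⟩⟩
  · rintro x _ ⟨k, hk, rfl⟩
    rw [F.map_smul, hφ, T.act_eq n k hk]
  · rintro g ⟨x⟩
    exact (congrArg φ (F.map_smul g x)).trans (hφ _ _)
  · rintro ⟨e⟩ c d hs g hc hd
    replace hs : (T.S n).tree.EdgeSeparates c d (φ (F.f (X.bd false e)))
      (φ (F.f (X.bd true e))) := hs
    rcases F.adj e with h | h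
    · rw [h] at hs
      exact absurd (hs .nil) (by simp)
    · obtain ⟨h', h1, h2, hk⟩ := hst _ _ h c d hs g hc hd
      have h3 : h' • e = e := F.stab e h h' h1 h2
      have h4 : (h'⁻¹ * g) • GGraph.kMk (T.K n) e = GGraph.kMk (T.K n) e := by
        rw [← GGraph.kMk_smul, eq_comm, GGraph.kMk_eq_iff]
        exact ⟨_, hk, rfl⟩
      change g • GGraph.kMk (T.K n) e = GGraph.kMk (T.K n) e
      rw [mul_smul, inv_smul_eq_iff, ← GGraph.kMk_smul (T.K n) h' e, h3] at h4
      exact h4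

/-- Over one of the trees there is a graph all of whose quotients are trees: any graph whose
complexity is the least possible among all graphs over all trees of the sequence. -/
theorem exists_quot_acyclic (X₀ : GGraph.{u, v} Γ) (F₀ : X₀.Over (T.S 0)) (hX₀ : X₀.Conn)
    (hf₀ : X₀.Cofinite) : ∃ (m : ℕ) (X : GGraph.{u, v} Γ) (F : X.Over (T.S m)), X.Conn ∧
      X.Cofinite ∧ F.NonDegenerate ∧ ∀ n, m ≤ n → (X.quot (T.K n)).Acyclic ∧
      ∀ A : Subgroup Γ, (T.S n).IsElliptic A → (X.quot (T.K n)).Elliptic A := by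
  let P : ℤ → Prop := fun c => ∃ (m : ℕ) (X : GGraph.{u, v} Γ), Nonempty (X.Over (T.S m)) ∧
    X.Conn ∧ X.Cofinite ∧ X.complexity = c
  obtain ⟨c, ⟨m, X, ⟨F⟩, hX, hf, hc⟩, hleast⟩ := Int.exists_least_of_bdd (P := P)
    ⟨-2, by
      rintro _ ⟨m, X, -, h1, h2, rfl⟩
      exact GGraph.neg_two_le_complexity h1 h2⟩ ⟨_, 0, X₀, ⟨F₀⟩, hX₀, hf₀, rfl⟩
  have hmin : X.IsMinimal (T.S m) := fun Y h1 h2 h3 =>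
    hc.trans_le (hleast _ ⟨m, Y, h1, h2, h3, rfl⟩)
  obtain ⟨Y, G, hY, hYf, hdeg, hle⟩ := hmin.exists_nonDegenerate F hX hf
  refine ⟨m, Y, G, hY, hYf, hdeg, fun n hn => ?_⟩
  obtain ⟨G'⟩ := T.nonempty_pathOver hn G
  exact GGraph.quot_acyclic_and_elliptic hY hYf (T.K n) G' fun Z h1 h2 h3 =>
    (hle.trans_eq hc).trans (hleast _ ⟨n, Z, h1, h2, h3, rfl⟩)

end TreeSequence

namespace GGraph

variable {Γ : Type u} [Group Γ] {X : GGraph.{u, v} Γ}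

/-- If the quotients by an increasing sequence of normal subgroups are acyclic, then so is the
quotient by their union. -/
theorem acyclic_quot_iUnion (hX : X.Conn) {K : ℕ → Subgroup Γ} [∀ n, (K n).Normal]
    {L : Subgroup Γ} [L.Normal] {m : ℕ} (hL : ∀ g, g ∈ L ↔ ∃ n, m ≤ n ∧ g ∈ K n)
    (h : ∀ n, m ≤ n → (X.quot (K n)).Acyclic) : (X.quot L).Acyclic := by
  intro c
  have hle : ∀ n, m ≤ n → ∀ k ∈ K n, ∀ e : X.E, kMk L (k • e) = kMk L e := fun n hn k hk e =>
    ((kMk_eq_iff L).2 ⟨k, (hL k).2 ⟨n, hn, hk⟩, rfl⟩).symm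
  -- By connectedness the primitives on the various quotients agree up to a constant, so that
  -- each of them is invariant under all the subgroups.
  have key : ∀ n, m ≤ n → ∃ b : X.V → ZMod 2, (∀ k ∈ K n, ∀ x, b (k • x) = b x) ∧
      ∀ e, X.cobd b e = c (kMk L e) := by
    intro n hn
    obtain ⟨b, hb⟩ := h n hn (Quot.lift (fun e => c (kMk L e)) (by
      rintro e _ ⟨k, hk, rfl⟩
      rw [hle n hn k hk]))
    refine ⟨fun x => b (kMk (K n) x), fun k hk x => ?_, fun e => hb (kMk (K n) e)⟩
    exact congrArg b ((kMk_eq_iff _).2 ⟨k, hk, rfl⟩).symm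
  obtain ⟨b, -, hb⟩ := key m le_rfl
  have hinv : ∀ k ∈ L, ∀ x, b (k • x) = b x := by
    intro k hk x
    obtain ⟨n, hn, hk⟩ := (hL k).1 hk
    obtain ⟨b', hb'1, hb'2⟩ := key n hn
    have h1 := hX.eq_of_cobd (fun v => b v + b' v) (fun e => by
      rw [X.cobd_add, hb, hb'2, CharTwo.add_self_eq_zero]) (k • x) x
    simp only [hb'1 k hk] at h1
    exact add_right_cancel h1
  refine ⟨Quot.lift b (by
    rintro x _ ⟨k, hk, rfl⟩
    exact (hinv k hk x).symm), ?_⟩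
  rintro ⟨e⟩
  exact hb e

theorem elliptic_quot_mono {K L : Subgroup Γ} [K.Normal] [L.Normal] (hKL : K ≤ L)
    {A : Subgroup Γ} (h : (X.quot K).Elliptic A) : (X.quot L).Elliptic A := by
  obtain ⟨x, hx⟩ := h
  obtain ⟨x, rfl⟩ := kMk_surjective K x
  refine ⟨kMk L x, fun g hg => ?_⟩
  obtain ⟨k, hk, hkx⟩ := (smul_kMk_eq_iff K).1 (hx g hg)
  exact (smul_kMk_eq_iff L).2 ⟨k, hKL hk, hkx⟩

end GGraph

/-- The limit action is non-trivial. As no `H i` fixes an edge, a global fixed point is the only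
fixed point of each `H i`, so that a fixed vertex of `H i` at a finite stage becomes this point at a
later stage. By finite generation the whole group then has a fixed point at a finite stage. -/
theorem TreeSequence.not_elliptic_top {Γ : Type u} [Group Γ] {W : ℕ → Type v}
    (T : TreeSequence Γ W) (hnt : ∀ n, (T.S n).IsNontrivial) {m : ℕ} {X : GGraph.{u, v} Γ}
    (F : X.Over (T.S m)) (hX : X.Conn)
    (hell : ∀ n, m ≤ n → ∀ A : Subgroup Γ, (T.S n).IsElliptic A → (X.quot (T.K n)).Elliptic A)
    {L : Subgroup Γ} [L.Normal] (hL : ∀ g, g ∈ L ↔ ∃ n, m ≤ n ∧ g ∈ T.K n)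
    (hac : (X.quot L).Acyclic) {p : ℕ} {H : Fin p → Subgroup Γ} (hfg : IsFGPair H)
    (hH : ∀ i, (T.S 0).IsElliptic (H i))
    (hedge : ∀ e i, ∃ h ∈ H i, h • GGraph.kMk L (A := X.E) e ≠ GGraph.kMk L e) :
    ¬ (X.quot L).Elliptic ⊤ := by
  rintro ⟨o, ho⟩
  obtain ⟨x, rfl⟩ := GGraph.kMk_surjective L o
  obtain ⟨s, hs, hgen⟩ := hfg
  have hel : ∀ i, ∃ y : X.V, ∀ h ∈ H i, h • GGraph.kMk (T.K m) y = GGraph.kMk (T.K m) y := by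
    intro i
    obtain ⟨y, hy⟩ := hell m le_rfl (H i) (T.isElliptic_mono (Nat.zero_le m) (hH i))
    obtain ⟨y, rfl⟩ := GGraph.kMk_surjective _ y
    exact ⟨y, hy⟩
  choose y hy using hel
  have hLm : T.K m ≤ L := fun k hk => (hL k).2 ⟨m, le_rfl, hk⟩
  have hxy : ∀ i, ∃ n, m ≤ n ∧ ∃ k ∈ T.K n, k • y i = x := by
    intro i
    have h1 : GGraph.kMk L (y i) = GGraph.kMk L x := by
      by_contra hne
      obtain ⟨e, he⟩ := GGraph.exists_edge_fixed (hX.quot L) hac hne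
      obtain ⟨e, rfl⟩ := GGraph.kMk_surjective L e
      obtain ⟨h, hh, hhe⟩ := hedge e i
      refine hhe (he h ?_ (ho h trivial))
      obtain ⟨k, hk, hkx⟩ := (GGraph.smul_kMk_eq_iff _).1 (hy i h hh)
      exact (GGraph.smul_kMk_eq_iff L).2 ⟨k, hLm hk, hkx⟩
    obtain ⟨k, hk, hkx⟩ := (GGraph.kMk_eq_iff L).1 h1
    obtain ⟨n, hn, hk⟩ := (hL k).1 hk
    exact ⟨n, hn, k, hk, hkx⟩
  have hgx : ∀ g : Γ, ∃ n, m ≤ n ∧ ∃ k ∈ T.K n, (k * g) • x = x := by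
    intro g
    obtain ⟨k, hk, hkx⟩ := (GGraph.smul_kMk_eq_iff L).1 (ho g trivial)
    obtain ⟨n, hn, hk⟩ := (hL k).1 hk
    exact ⟨n, hn, k, hk, hkx⟩
  choose ny hny ky hky hkyx using hxy
  choose ng hng kg hkg hkgx using hgx
  obtain ⟨N₁, hN₁⟩ := (Set.finite_range ny).bddAbove
  obtain ⟨N₂, hN₂⟩ := (hs.image ng).bddAbove
  let n := max m (max N₁ N₂)
  have hmn : m ≤ n := le_max_left _ _
  -- All the fixed points agree in the quotient by `K n`.
  have hfix : ∀ g : Γ, g • GGraph.kMk (T.K n) x = GGraph.kMk (T.K n) x := by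
    have htop : MulAction.stabilizer Γ (GGraph.kMk (T.K n) x) = ⊤ := by
      rw [eq_top_iff, ← hgen, Subgroup.closure_le]
      rintro g (hg | hg)
      · have : ng g ≤ n := (hN₂ ⟨g, hg, rfl⟩).trans ((le_max_right _ _).trans (le_max_right _ _))
        exact (GGraph.smul_kMk_eq_iff _).2 ⟨kg g, T.mono this (hkg g), hkgx g⟩
      · obtain ⟨i, hg⟩ := Set.mem_iUnion.1 hg
        have : ny i ≤ n := (hN₁ ⟨i, rfl⟩).trans ((le_max_left _ _).trans (le_max_right _ _))
        have h1 : GGraph.kMk (T.K n) (y i) = GGraph.kMk (T.K n) x :=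
          (GGraph.kMk_eq_iff _).2 ⟨ky i, T.mono this (hky i), hkyx i⟩
        obtain ⟨k, hk, hkx⟩ := (GGraph.smul_kMk_eq_iff _).1 (hy i g hg)
        rw [← h1]
        exact (GGraph.smul_kMk_eq_iff _).2 ⟨k, T.mono hmn hk, hkx⟩
    intro g
    have : g ∈ MulAction.stabilizer Γ (GGraph.kMk (T.K n) x) := htop ▸ Subgroup.mem_top g
    exact this
  obtain ⟨F'⟩ := T.nonempty_pathOver hmn F
  exact hnt n ⟨F'.f (GGraph.kMk (T.K n) x), fun g _ =>
    (F'.map_smul g _).symm.trans (congrArg F'.f (hfix g))⟩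

/-! ### Reduction to one orbit of edges -/

namespace GGraph

variable {Γ : Type u} [Group Γ] {X : GGraph.{u, v} Γ}

theorem Conn.nonempty_edges (hX : X.Conn) (hnt : ¬ X.Elliptic ⊤) : Nonempty X.E := by
  by_contra hE
  rw [not_nonempty_iff] at hE
  obtain ⟨x⟩ := hX.nonempty
  exact hnt ⟨x, fun g _ => hX.induction (P := fun y => y = x) (fun e => hE.elim e) rfl (g • x)⟩

/-- An invariant subgraph. -/
def restrict (X : GGraph.{u, v} Γ) (Z : SubMulAction Γ X.V) (p : SubMulAction Γ X.E)
    (h : ∀ i, ∀ e ∈ p, X.bd i e ∈ Z) : GGraph.{u, v} Γ where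
  V := Z
  E := p
  bd i e := ⟨X.bd i e, h i e e.2⟩
  bd_smul i g e := Subtype.ext (X.bd_smul i g e.1)

theorem Acyclic.restrict (ha : X.Acyclic) {Z : SubMulAction Γ X.V} {p : SubMulAction Γ X.E}
    {h : ∀ i, ∀ e ∈ p, X.bd i e ∈ Z} : (X.restrict Z p h).Acyclic := by
  classical
  intro c
  obtain ⟨b, hb⟩ := ha fun e => if he : e ∈ p then c ⟨e, he⟩ else 0
  refine ⟨fun v => b v.1, fun e => ?_⟩
  have h1 := hb e.1
  rw [dif_pos e.2] at h1
  exact h1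

/-- An elliptic subgroup is elliptic in each invariant subtree. -/
theorem Elliptic.restrict (hX : X.Conn) (ha : X.Acyclic) {Z : SubMulAction Γ X.V}
    {p : SubMulAction Γ X.E} {h : ∀ i, ∀ e ∈ p, X.bd i e ∈ Z} (hY : (X.restrict Z p h).Conn)
    {A : Subgroup Γ} (hA : X.Elliptic A) : (X.restrict Z p h).Elliptic A := by
  obtain ⟨a, hA⟩ := hA
  obtain ⟨z, hz, hfix⟩ := (isTree_simpleGraph hX ha).exists_fixed_of_invariant
    (A := (X.toTreeAction hX ha).act '' A) (Z := {x | x ∈ Z}) (hY.nonempty.elim fun z => ⟨z.1, z.2⟩)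
    (by
      rintro _ ⟨g, -, rfl⟩ x hx
      exact Z.smul_mem g hx) (by
      intro x hx y hy
      have key : ∀ i (e : p), (∃ w : (simpleGraph ha).Walk x (X.bd i e.1),
          ∀ v ∈ w.support, v ∈ Z) → ∃ w : (simpleGraph ha).Walk x (X.bd (!i) e.1),
          ∀ v ∈ w.support, v ∈ Z := by
        rintro i e ⟨w, hw⟩
        have hadj : (simpleGraph ha).Adj (X.bd i e.1) (X.bd (!i) e.1) := ⟨i, e.1, rfl, rfl⟩
        refine ⟨w.concat hadj, fun v hv => ?_⟩
        rw [SimpleGraph.Walk.support_concat, List.mem_append, List.mem_singleton] at hv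
        rcases hv with hv | rfl
        · exact hw v hv
        · exact h _ _ e.2
      refine hY.induction (P := fun y : Z => ∃ w : (simpleGraph ha).Walk x y.1,
        ∀ v ∈ w.support, v ∈ Z) (fun e => ⟨key false e, key true e⟩) (x := ⟨x, hx⟩)
        ⟨.nil, fun v hv => ?_⟩ ⟨y, hy⟩
      rw [SimpleGraph.Walk.support_nil, List.mem_singleton] at hv
      exact hv ▸ hx) (a := a) (by
      rintro _ ⟨g, hg, rfl⟩
      exact hA g hg)
  exact ⟨⟨z, hz⟩, fun g hg => Subtype.ext (hfix _ ⟨g, hg, rfl⟩)⟩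

/-- The graph obtained by collapsing the orbit of an edge. -/
def collapse (X : GGraph.{u, v} Γ) (e : X.E) : GGraph.{u, v} Γ :=
  X.push (mergeMk Γ (X.bd false e) (X.bd true e)) (mergeMk_smul _ _) (orbitCompl Γ e)

theorem Conn.collapse (hX : X.Conn) (e : X.E) : (X.collapse e).Conn :=
  hX.push (mergeMk_surjective _ _) fun b hb =>
    (mergeData_collapse e false).cobd_eq_zero
      (b := fun v => b (mergeMk Γ (X.bd false e) (X.bd true e) v))
      (fun g => congrArg b (mergeMk_eq _ _ g)) hb

theorem Acyclic.collapse (ha : X.Acyclic) (e : X.E) : (X.collapse e).Acyclic := by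
  classical
  intro c
  obtain ⟨b, hb⟩ := ha fun e' => if he : e' ∈ orbitCompl Γ e then c ⟨e', he⟩ else 0
  refine ⟨mergeLift b fun g => ?_, fun e' => ?_⟩
  · have h1 := hb (g • e)
    rw [dif_neg (by rw [mem_orbitCompl, not_not, orbitMk_smul]), X.cobd_eq_zero_iff,
      X.bd_smul, X.bd_smul] at h1
    exact h1
  · have h1 := hb e'.1
    rw [dif_pos e'.2] at h1
    exact h1

section Component

variable (e : X.E) (z : (X.collapse e).V)

/-- The vertices of the subtree that is collapsed to the vertex `z`, when `z` is fixed. -/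
def fibre (hz : ∀ g : Γ, g • z = z) : SubMulAction Γ X.V where
  carrier := {x | mergeMk Γ (X.bd false e) (X.bd true e) x = z}
  smul_mem' g x hx := by
    have hx' : mergeMk Γ (X.bd false e) (X.bd true e) x = z := hx
    have h1 : g • mergeMk Γ (X.bd false e) (X.bd true e) x = z :=
      (congrArg (g • ·) hx').trans (hz g)
    exact h1

/-- The edges of the subtree that is collapsed to the vertex `z`, when `z` is fixed. -/
def fibreEdges (hz : ∀ g : Γ, g • z = z) : SubMulAction Γ X.E where
  carrier := {e' | orbitMk Γ e' = orbitMk Γ e ∧ X.bd false e' ∈ fibre e z hz}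
  smul_mem' g e' he := ⟨(orbitMk_smul g e').trans he.1, by
    rw [X.bd_smul]; exact (fibre e z hz).smul_mem g he.2⟩

variable {e z} {hz : ∀ g : Γ, g • z = z}

theorem mem_fibre_iff {e' : X.E} (he : orbitMk Γ e' = orbitMk Γ e) :
    X.bd false e' ∈ fibre e z hz ↔ X.bd true e' ∈ fibre e z hz := by
  obtain ⟨g, rfl⟩ := orbitMk_eq_iff.1 he
  rw [X.bd_smul, X.bd_smul]
  have h := mergeMk_eq (X.bd false e) (X.bd true e) g
  exact ⟨fun h' => h.symm.trans h', fun h' => h.trans h'⟩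

theorem bd_mem_fibre (i : Bool) (e' : X.E) (he : e' ∈ fibreEdges e z hz) :
    X.bd i e' ∈ fibre e z hz := by
  cases i
  · exact he.2
  · exact (mem_fibre_iff he.1).1 he.2

theorem conn_fibre : (X.restrict (fibre e z hz) (fibreEdges e z hz) bd_mem_fibre).Conn where
  nonempty := by
    obtain ⟨x, hx⟩ := mergeMk_surjective (X.bd false e) (X.bd true e) z
    exact ⟨⟨x, hx⟩⟩
  eq_of_cobd b hb x y := by
    classical
    -- Extended by zero, the function descends to the collapsed tree.
    let B : X.V → ZMod 2 := fun v => if h : v ∈ fibre e z hz then b ⟨v, h⟩ else 0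
    have hB : ∀ g : Γ, B (g • X.bd false e) = B (g • X.bd true e) := by
      intro g
      rw [← X.bd_smul, ← X.bd_smul]
      have he : orbitMk Γ (g • e) = orbitMk Γ e := orbitMk_smul g e
      have hiff := mem_fibre_iff (z := z) (hz := hz) he
      by_cases h : X.bd false (g • e) ∈ fibre e z hz
      · simp only [B, dif_pos h, dif_pos (hiff.1 h)]
        exact (cobd_eq_zero_iff _ b ⟨g • e, he, h⟩).1 (hb ⟨g • e, he, h⟩)
      · simp only [B, dif_neg h, dif_neg (fun h' => h (hiff.2 h'))]
    have key : ∀ x : fibre e z hz, b x = mergeLift B hB z := by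
      intro x
      have h1 : mergeMk Γ (X.bd false e) (X.bd true e) x.1 = z := x.2
      have h2 : mergeLift B hB (mergeMk Γ (X.bd false e) (X.bd true e) x.1) = b x :=
        dif_pos x.2
      rw [← h2]
      exact congrArg _ h1
    exact (key x).trans (key y).symm

end Component

/-- A non-trivial action on a tree yields a non-trivial action on a tree with one orbit of edges:
either a collapse of an orbit of edges is non-trivial, or it has a fixed vertex, whose preimage is
an invariant subtree with one orbit of edges. -/
theorem exists_transitive (hX : X.Conn) (ha : X.Acyclic) (hf : X.Cofinite)
    (hnt : ¬ X.Elliptic ⊤) : ∃ Y : GGraph.{u, v} Γ, Y.Conn ∧ Y.Acyclic ∧ ¬ Y.Elliptic ⊤ ∧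
      (∃ e₀ : Y.E, ∀ e, ∃ g : Γ, g • e₀ = e) ∧
      (∀ e : Y.E, ∃ e' : X.E, ∀ g : Γ, g • e = e ↔ g • e' = e') ∧
      (∀ A, X.Elliptic A → Y.Elliptic A) ∧
      (∀ g : Γ, (∀ x : X.V, g • x = x) → ∀ y : Y.V, g • y = y) := by
  induction hn : Nat.card X.OE using Nat.strong_induction_on generalizing X with
  | _ n ih =>
  have hE := hf.finE
  obtain ⟨e⟩ := hX.nonempty_edges hnt
  by_cases hall : ∀ e', orbitMk Γ e' = orbitMk Γ e
  · exact ⟨X, hX, ha, hnt, ⟨e, fun e' => orbitMk_eq_iff.1 (hall e')⟩,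
      fun e => ⟨e, fun _ => Iff.rfl⟩, fun _ h => h, fun _ h => h⟩
  by_cases hc : (X.collapse e).Elliptic ⊤
  · obtain ⟨z, hz⟩ := hc
    have hz' : ∀ g : Γ, g • z = z := fun g => hz g trivial
    have hY := conn_fibre (e := e) (hz := hz')
    have hnt' : ¬ (X.restrict (fibre e z hz') (fibreEdges e z hz') bd_mem_fibre).Elliptic ⊤ := by
      rintro ⟨x, hx⟩
      exact hnt ⟨x.1, fun g hg => congrArg Subtype.val (hx g hg)⟩
    obtain ⟨e₀⟩ := hY.nonempty_edges hnt'
    refine ⟨_, hY, ha.restrict, hnt', ⟨e₀, fun e' => ?_⟩, fun e' => ⟨e'.1, fun g => ?_⟩,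
      fun A hA => hA.restrict hX ha hY, fun g hg y => Subtype.ext (hg y.1)⟩
    · obtain ⟨g, hg⟩ := orbitMk_eq_iff.1 (e'.2.1.trans e₀.2.1.symm)
      exact ⟨g, Subtype.ext hg⟩
    · exact ⟨fun h => congrArg Subtype.val h, fun h => Subtype.ext h⟩
  · have hlt : Nat.card (X.collapse e).OE < n := hn ▸
      natCard_orbits_subMulAction_lt (orbitCompl Γ e) (a := e) (by simp [mem_orbitCompl])
    obtain ⟨Y, h1, h2, h3, h4, h5, h6, h7⟩ := ih _ hlt (hX.collapse e) (ha.collapse e)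
      (hf.push (mergeMk_surjective _ _)) hc rfl
    refine ⟨Y, h1, h2, h3, h4, fun e' => ?_, fun A ⟨x, hx⟩ => h6 A
      ⟨mergeMk Γ _ _ x, fun g hg => congrArg (mergeMk Γ _ _) (hx g hg)⟩, fun g hg => h7 g ?_⟩
    · obtain ⟨e'', he''⟩ := h5 e'
      exact ⟨e''.1, fun g => (he'' g).trans
        ⟨fun h => congrArg Subtype.val h, fun h => Subtype.ext h⟩⟩
    · intro y
      obtain ⟨x, rfl⟩ := mergeMk_surjective (X.bd false e) (X.bd true e) y
      exact congrArg (mergeMk Γ _ _) (hg x)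

end GGraph

/-! ### Changing the group and the vertex set -/

namespace TreeAction

/-- The action of `Γ` obtained from an action of `G` and a morphism `Γ → G`. -/
def comapHom {Γ G : Type u} [Group Γ] [Group G] {V : Type v} (S : TreeAction G V) (φ : Γ →* G) :
    TreeAction Γ V where
  tree := S.tree
  isTree := S.isTree
  act := S.act.comp φ
  noInversion g := S.noInversion (φ g)

/-- An action descends to a quotient by a group acting trivially; moreover, the vertex set can be
replaced by an equivalent type in another universe. -/
theorem exists_descend {Γ G : Type u} [Group Γ] [Group G] {V : Type v} [Small.{u} V]
    (S : TreeAction Γ V) {Φ : Γ →* G} (hΦ : Function.Surjective Φ)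
    (hker : ∀ g, Φ g = 1 → ∀ x, S.act g x = x) :
    ∃ (W : Type u) (T : TreeAction G W) (ι : V ≃ W),
      (∀ a b, T.tree.Adj (ι a) (ι b) ↔ S.tree.Adj a b) ∧
      ∀ g a, T.act (Φ g) (ι a) = ι (S.act g a) := by
  let ι : V ≃ Shrink.{u} V := equivShrink V
  let tree : SimpleGraph (Shrink.{u} V) := S.tree.comap ι.symm
  let I : S.tree ≃g tree :=
    { toEquiv := ι
      map_rel_iff' := by
        intro a b
        simp [tree] }
  let act' : Γ →* (tree ≃g tree) :=
    { toFun := fun g => (I.symm.trans (S.act g)).trans I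
      map_one' := by
        refine RelIso.ext fun x => ?_
        change I ((S.act 1) (I.symm x)) = x
        rw [map_one]
        exact I.apply_symm_apply x
      map_mul' := fun g h => by
        refine RelIso.ext fun x => ?_
        change I ((S.act (g * h)) (I.symm x)) = I (S.act g (I.symm (I (S.act h (I.symm x)))))
        rw [map_mul, I.symm_apply_apply]
        rfl }
  have hact' : ∀ g x, act' g (ι x) = ι (S.act g x) := by
    intro g x
    change ι (S.act g (ι.symm (ι x))) = _
    rw [ι.symm_apply_apply]
  have hk : Φ.ker ≤ act'.ker := by
    intro g hg
    rw [MonoidHom.mem_ker]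
    refine RelIso.ext fun x => ?_
    obtain ⟨x, rfl⟩ := ι.surjective x
    rw [hact', hker g hg]
    rfl
  let act : G →* (tree ≃g tree) := Φ.liftOfSurjective hΦ ⟨act', hk⟩
  have hact : ∀ g, act (Φ g) = act' g := fun g =>
    MonoidHom.liftOfRightInverse_comp_apply _ _ _ ⟨act', hk⟩ g
  refine ⟨Shrink.{u} V, ⟨tree, I.isTree_iff.1 S.isTree, act, ?_⟩, ι, fun a b => ?_, fun g a => ?_⟩
  · intro g a b hab h
    obtain ⟨g, rfl⟩ := hΦ g
    obtain ⟨a, rfl⟩ := ι.surjective a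
    obtain ⟨b, rfl⟩ := ι.surjective b
    rw [hact, hact', hact', ι.apply_eq_iff_eq, ι.apply_eq_iff_eq] at h
    exact S.noInversion g a b (I.map_rel_iff.1 hab) h
  · exact I.map_rel_iff
  · exact (congrArg (fun σ : tree ≃g tree => σ (ι a)) (hact g)).trans (hact' g a)

/-! ### Cofinite subtrees -/

variable {Γ : Type u} [Group Γ] {V : Type v} (S : TreeAction Γ V)

/-- The action on the vertices of the tree. -/
@[reducible]
def vertexAction : MulAction Γ V where
  smul g x := S.act g x
  one_smul x := by
    change S.act 1 x = x
    rw [map_one]; rfl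
  mul_smul g h x := by
    change S.act (g * h) x = S.act g (S.act h x)
    rw [map_mul]; rfl

/-- The action on the oriented edges of the tree. -/
@[reducible]
def dartAction : MulAction Γ S.tree.Dart where
  smul g d := ⟨(S.act g d.fst, S.act g d.snd), (S.act g).map_rel_iff.2 d.adj⟩
  one_smul d := by
    have h : ∀ x, S.act 1 x = x := fun x => by rw [map_one]; rfl
    exact SimpleGraph.Dart.ext _ _ (Prod.ext (h _) (h _))
  mul_smul g h d := by
    have h : ∀ x, S.act (g * h) x = S.act g (S.act h x) := fun x => by rw [map_mul]; rfl
    exact SimpleGraph.Dart.ext _ _ (Prod.ext (h _) (h _))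

/-- The graph with one edge for each oriented edge of the tree. -/
def dartGraph : GGraph.{u, v} Γ where
  V := V
  E := S.tree.Dart
  actV := S.vertexAction
  actE := S.dartAction
  bd i d := cond i d.snd d.fst
  bd_smul i g d := by cases i <;> rfl

/-- For a finitely generated pair, there is a connected cofinite graph over the tree: it consists of
the translates of finitely many geodesics starting at a base point. -/
theorem exists_cofinite_over {p : ℕ} {H : Fin p → Subgroup Γ} (hfg : IsFGPair H)
    (hell : ∀ i, S.IsElliptic (H i)) :
    ∃ X : GGraph.{u, v} Γ, Nonempty (X.Over S) ∧ X.Conn ∧ X.Cofinite := by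
  obtain ⟨F, hF, hgen⟩ := hfg
  choose a ha using hell
  obtain ⟨v₀⟩ := S.isTree.connected.nonempty
  let D := S.dartGraph
  let Y : Set V := (fun g => S.act g v₀) '' F ∪ Set.range a ∪ {v₀}
  have hY : Y.Finite := ((hF.image _).union (Set.finite_range a)).union (Set.finite_singleton _)
  let OZ : Set D.OV := ⋃ y ∈ Y, orbitMk Γ (A := D.V) '' {x | x ∈ (S.isTree.geodesic v₀ y).support}
  let Op : Set D.OE := ⋃ y ∈ Y, orbitMk Γ (A := D.E) '' {d | d ∈ (S.isTree.geodesic v₀ y).darts}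
  have hOZ : OZ.Finite := hY.biUnion fun y _ => (List.finite_toSet _).image _
  have hOp : Op.Finite := hY.biUnion fun y _ => (List.finite_toSet _).image _
  let Z : SubMulAction Γ D.V :=
    { carrier := {x | orbitMk Γ (A := D.V) x ∈ OZ}
      smul_mem' := fun g x hx => by
        change orbitMk Γ (A := D.V) (g • x) ∈ OZ
        rw [orbitMk_smul]; exact hx }
  let q : SubMulAction Γ D.E :=
    { carrier := {d | orbitMk Γ (A := D.E) d ∈ Op}
      smul_mem' := fun g x hx => by
        change orbitMk Γ (A := D.E) (g • x) ∈ Op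
        rw [orbitMk_smul]; exact hx }
  have hZY : ∀ y ∈ Y, ∀ x ∈ (S.isTree.geodesic v₀ y).support, x ∈ Z := fun y hy x hx =>
    Set.mem_biUnion hy ⟨x, hx, rfl⟩
  have hqY : ∀ y ∈ Y, ∀ d ∈ (S.isTree.geodesic v₀ y).darts, d ∈ q := fun y hy d hd =>
    Set.mem_biUnion hy ⟨d, hd, rfl⟩
  have hbd : ∀ i, ∀ e ∈ q, D.bd i e ∈ Z := by
    intro i e he
    obtain ⟨y, hy, d, hd, hde⟩ := Set.mem_iUnion₂.1 he
    obtain ⟨g, rfl⟩ := orbitMk_eq_iff.1 hde.symm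
    rw [D.bd_smul]
    refine Z.smul_mem g ?_
    cases i
    · exact hZY y hy _ (SimpleGraph.Walk.dart_fst_mem_support_of_mem_darts _ hd)
    · exact hZY y hy _ (SimpleGraph.Walk.dart_snd_mem_support_of_mem_darts _ hd)
  have hv₀ : v₀ ∈ Z := hZY v₀ (Or.inr rfl) v₀ (SimpleGraph.Walk.start_mem_support _)
  refine ⟨D.restrict Z q hbd, ⟨⟨fun x => x.1, fun g x => rfl, fun e => Or.inr e.1.adj, ?_⟩⟩, ?_, ?_⟩
  · intro e _ g h1 h2
    exact Subtype.ext (SimpleGraph.Dart.ext _ _ (Prod.ext h1 h2))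
  · refine ⟨⟨⟨v₀, hv₀⟩⟩, fun b hb => ?_⟩
    classical
    let B : D.V → ZMod 2 := fun x => if h : x ∈ Z then b ⟨x, h⟩ else 0
    have hBe : ∀ d ∈ q, B (D.bd false d) = B (D.bd true d) := by
      intro d hd
      simp only [B, dif_pos (hbd false d hd), dif_pos (hbd true d hd)]
      exact (GGraph.cobd_eq_zero_iff _ b ⟨d, hd⟩).1 (hb ⟨d, hd⟩)
    have hwalk : ∀ (x y : V) (w : S.tree.Walk x y), (∀ d ∈ w.darts, d ∈ q) →
        ∀ z ∈ w.support, ∀ g : Γ, B (S.act g x) = B (S.act g z) := by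
      intro x y w
      induction w with
      | nil =>
        intro _ z hz g
        rw [SimpleGraph.Walk.support_nil, List.mem_singleton] at hz
        rw [hz]
      | @cons x x' y h w ih =>
        intro hw z hz g
        rw [SimpleGraph.Walk.support_cons, List.mem_cons] at hz
        rcases hz with rfl | hz
        · rfl
        · rw [← ih (fun d hd => hw d (by
            rw [SimpleGraph.Walk.darts_cons]; exact List.mem_cons_of_mem _ hd)) z hz g]
          have h1 : (⟨(x, x'), h⟩ : S.tree.Dart) ∈ q := hw _ (by
            rw [SimpleGraph.Walk.darts_cons]; exact List.mem_cons_self)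
          exact hBe _ (q.smul_mem g h1)
    have hgeo : ∀ y ∈ Y, ∀ z ∈ (S.isTree.geodesic v₀ y).support, ∀ g : Γ,
        B (S.act g v₀) = B (S.act g z) := fun y hy => hwalk _ _ _ (hqY y hy)
    have hmul : ∀ (g h : Γ) (x : V), S.act (g * h) x = S.act g (S.act h x) := fun g h x => by
      rw [map_mul]; rfl
    -- As `B` is constant along the edges, right multiplication by a generator `g` does not change
    -- the value of `B` at a translate of `v₀`: use the geodesic from `v₀` to `g • v₀` if `g ∈ F`,
    -- and a fixed point of `H i` if `g ∈ H i`.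
    let N : Subgroup Γ :=
      { carrier := {g | ∀ h : Γ, B (S.act (h * g) v₀) = B (S.act h v₀)}
        one_mem' := fun h => by rw [mul_one]
        mul_mem' := fun {g g'} hg hg' h => by rw [← mul_assoc, hg' (h * g), hg h]
        inv_mem' := fun {g} hg h => by
          have := hg (h * g⁻¹)
          rw [inv_mul_cancel_right] at this
          exact this.symm }
    have hN : N = ⊤ := by
      rw [eq_top_iff, ← hgen, Subgroup.closure_le]
      rintro g (hg | hg) h
      · rw [hmul]
        exact (hgeo (S.act g v₀) (Or.inl (Or.inl ⟨g, hg, rfl⟩)) _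
          (SimpleGraph.Walk.end_mem_support _) h).symm
      · obtain ⟨i, hg⟩ := Set.mem_iUnion.1 hg
        have h1 := hgeo (a i) (Or.inl (Or.inr ⟨i, rfl⟩)) _ (SimpleGraph.Walk.end_mem_support _)
        rw [h1, h1, hmul, ha i g hg]
    have key : ∀ x : Z, b x = B v₀ := by
      intro x
      obtain ⟨y, hy, z, hz, hzx⟩ := Set.mem_iUnion₂.1 x.2
      obtain ⟨g, hg⟩ := orbitMk_eq_iff.1 hzx.symm
      have h1 : B (S.act g v₀) = B x.1 := (hgeo y hy z hz g).trans (congrArg B hg)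
      have h2 : g ∈ N := hN ▸ Subgroup.mem_top g
      have h3 := h2 1
      rw [one_mul, map_one] at h3
      have h4 : B x.1 = b x := dif_pos x.2
      rw [← h4, ← h1, h3]
      rfl
    exact fun x y => (key x).trans (key y).symm
  · constructor
    · have := hOZ.to_subtype
      refine Finite.of_injective (β := OZ) (fun o => ⟨_, ?_⟩) fun o o' h =>
        orbitMk_val_injective Z (congrArg Subtype.val h)
      obtain ⟨x, rfl⟩ := orbitMk_surjective o
      exact x.2
    · have := hOp.to_subtype
      refine Finite.of_injective (β := Op) (fun o => ⟨_, ?_⟩) fun o o' h =>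
        orbitMk_val_injective q (congrArg Subtype.val h)
      obtain ⟨x, rfl⟩ := orbitMk_surjective o
      exact x.2

end TreeAction

/-- If there is one orbit of edges, then the vertices are parametrized by two copies of `Γ`. This is
what allows the vertex set of the limit tree to live in the universe of the groups. -/
theorem GGraph.small_vertices {Γ : Type u} [Group Γ] {Y : GGraph.{u, v} Γ} (hY : Y.Conn) {e₀ : Y.E}
    (he₀ : ∀ e, ∃ g : Γ, g • e₀ = e) : Small.{u} Y.V := by
  refine small_of_surjective (α := ULift.{u} Bool × Γ) (f := fun p => p.2 • Y.bd p.1.down e₀) ?_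
  refine fun y => hY.induction (P := fun y => ∃ p : ULift.{u} Bool × Γ,
    p.2 • Y.bd p.1.down e₀ = y) (fun e => ?_) (x := Y.bd false e₀)
    ⟨(⟨false⟩, 1), one_smul _ _⟩ y
  have h : ∀ i, ∃ p : ULift.{u} Bool × Γ, p.2 • Y.bd p.1.down e₀ = Y.bd i e := by
    intro i
    obtain ⟨g, rfl⟩ := he₀ e
    exact ⟨(⟨i⟩, g), (Y.bd_smul i g e₀).symm⟩
  exact ⟨fun _ => h true, fun _ => h false⟩

/-! ### The limit of the sequence -/

section SeqLimitFacts

variable {G : ℕ → Type u} [∀ k, Group (G k)] (φ : ∀ k, G k →* G (k + 1))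

theorem toSeqLimit_transition {k l : ℕ} (h : k ≤ l) (x : G k) :
    toSeqLimit φ l (transition φ k l h x) = toSeqLimit φ k x :=
  (DirectLimit.eq_of_le (F := G) (f := fun i j h => transition φ i j h) ⟨k, x⟩ l h).symm

theorem transition_surjective (hφ : ∀ k, Function.Surjective (φ k)) {k l : ℕ} (h : k ≤ l) :
    Function.Surjective (transition φ k l h) := by
  induction l, h using Nat.le_induction with
  | base => rw [transition_self]; exact Function.surjective_id
  | succ l h ih => rw [transition_succ φ k l h]; exact (hφ l).comp ih

theorem toSeqLimit_surjective (hφ : ∀ k, Function.Surjective (φ k)) :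
    Function.Surjective (toSeqLimit φ 0) := by
  intro z
  obtain ⟨k, x, rfl⟩ := DirectLimit.exists_eq_mk (F := G) (f := fun i j h => transition φ i j h) z
  obtain ⟨g, rfl⟩ := transition_surjective φ hφ (Nat.zero_le k) x
  exact ⟨g, (toSeqLimit_transition φ (Nat.zero_le k) g).symm⟩

theorem toSeqLimit_eq_one_iff (g : G 0) :
    toSeqLimit φ 0 g = 1 ↔ ∃ n, transition φ 0 n (Nat.zero_le n) g = 1 := by
  constructor
  · intro h
    rw [← map_one (toSeqLimit φ 0)] at h
    obtain ⟨n, h1, h2, h3⟩ := Quotient.exact h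
    refine ⟨n, ?_⟩
    have h4 : transition φ 0 n h1 g = transition φ 0 n h2 1 := h3
    rwa [map_one] at h4
  · rintro ⟨n, hn⟩
    rw [← toSeqLimit_transition φ (Nat.zero_le n), hn, map_one]

theorem ker_transition_mono :
    Monotone fun n => (transition φ 0 n (Nat.zero_le n)).ker := by
  refine monotone_nat_of_le_succ fun n g hg => ?_
  rw [MonoidHom.mem_ker] at hg ⊢
  rw [transition_succ φ 0 n (Nat.zero_le n), MonoidHom.comp_apply, hg, map_one]

end SeqLimitFacts

section Pullback

variable {G : ℕ → Type u} [∀ k, Group (G k)] {V : ℕ → Type v}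

/-- The trees of the sequence, with the induced actions of the first group. -/
def pullbackSequence (S : ∀ k, TreeAction (G k) (V k)) (f : ∀ k, TreeEpi (S k) (S (k + 1)))
    (hstar : ∀ k (e : (S k).tree.Dart) (e' : (S (k + 1)).tree.Dart), (f k).InImage e' e →
      (S (k + 1)).edgeStabilizer e' = ((S k).edgeStabilizer e).map (f k).hom) :
    TreeSequence (G 0) V where
  S n := (S n).comapHom (transition (fun k => (f k).hom) 0 n (Nat.zero_le n))
  K n := (transition (fun k => (f k).hom) 0 n (Nat.zero_le n)).ker
  normal n := inferInstance
  mono := ker_transition_mono _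
  act_eq n k hk x := by
    rw [MonoidHom.mem_ker] at hk
    change (S n).act (transition (fun k => (f k).hom) 0 n (Nat.zero_le n) k) x = x
    rw [hk, map_one]
    rfl
  f n := (f n).vert
  map_act n g x := by
    change (f n).vert ((S n).act _ x) = (S (n + 1)).act _ _
    rw [(f n).vert_equivariant, transition_succ (fun k => (f k).hom) 0 n (Nat.zero_le n)]
    rfl
  stab n a b hab c d hs g hc hd := by
    let e : (S n).tree.Dart := ⟨(a, b), hab⟩
    have hmem : s(c, d) ∈ ((f n).path e).edges := hs ((f n).path e)
    let e' : (S (n + 1)).tree.Dart := ⟨(c, d), ((f n).path e).adj_of_mem_edges hmem⟩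
    have hst := hstar n e e' hmem
    have hg : transition (fun k => (f k).hom) 0 (n + 1) (Nat.zero_le _) g ∈
        (S (n + 1)).edgeStabilizer e' := ⟨hc, hd⟩
    rw [hst] at hg
    obtain ⟨y, hy, hyg⟩ := hg
    obtain ⟨h, rfl⟩ := transition_surjective (fun k => (f k).hom)
      (fun k => (f k).hom_surjective) (Nat.zero_le n) y
    refine ⟨h, hy.1, hy.2, ?_⟩
    have : transition (fun k => (f k).hom) 0 (n + 1) (Nat.zero_le _) h =
        transition (fun k => (f k).hom) 0 (n + 1) (Nat.zero_le _) g := by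
      rw [← hyg, transition_succ (fun k => (f k).hom) 0 n (Nat.zero_le n)]
      rfl
    rw [MonoidHom.mem_ker, map_mul, map_inv, this, inv_mul_cancel]

end Pullback

theorem mainTheorem10 {p : ℕ} {G : ℕ → Type u} [∀ k, Group (G k)] {V : ℕ → Type v}
    (S : ∀ k, TreeAction (G k) (V k)) (H : ∀ k, Fin p → Subgroup (G k))
    (hfg : ∀ k, IsFGPair (H k))
    (hell : ∀ k i, (S k).IsElliptic (H k i))
    (hnontriv : ∀ k, (S k).IsNontrivial)
    (f : ∀ k, TreeEpi (S k) (S (k + 1)))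
    (hmap : ∀ k i, (H k i).map (f k).hom = H (k + 1) i)
    (hstar : ∀ k (e : (S k).tree.Dart) (e' : (S (k + 1)).tree.Dart), (f k).InImage e' e →
      (S (k + 1)).edgeStabilizer e' = ((S k).edgeStabilizer e).map (f k).hom)
    (hedge : ∀ k (e : (S k).tree.Dart) (i : Fin p),
      ¬ (H k i).map (toSeqLimit (fun k => (f k).hom) k) ≤
        ((S k).edgeStabilizer e).map (toSeqLimit (fun k => (f k).hom) k)) :
    ∃ (W : Type u) (T : TreeAction (SeqLimit (fun k => (f k).hom)) W),
      T.IsNontrivial ∧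
      (∀ k i, T.IsElliptic ((H k i).map (toSeqLimit (fun k => (f k).hom) k))) ∧
      (∃ (k : ℕ) (e : (S k).tree.Dart), T.IsSplittingOver
        (((S k).edgeStabilizer e).map (toSeqLimit (fun k => (f k).hom) k))) ∧
      ∀ (k : ℕ) (K : Subgroup (G k)), (S k).IsElliptic K →
        T.IsElliptic (K.map (toSeqLimit (fun k => (f k).hom) k)) := by
  let φ : ∀ k, G k →* G (k + 1) := fun k => (f k).hom
  have hφ : ∀ k, Function.Surjective (φ k) := fun k => (f k).hom_surjective
  let τ : ∀ n, G 0 →* G n := fun n => transition φ 0 n (Nat.zero_le n)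
  have hτ : ∀ n, Function.Surjective (τ n) := fun n => transition_surjective φ hφ _
  let Φ : ∀ n, G n →* SeqLimit φ := toSeqLimit φ
  have hΦ : Function.Surjective (Φ 0) := toSeqLimit_surjective φ hφ
  have hΦτ : ∀ n g, Φ n (τ n g) = Φ 0 g := fun n g => toSeqLimit_transition φ _ g
  let Q := pullbackSequence S f hstar
  let L : Subgroup (G 0) := (Φ 0).ker
  obtain ⟨X₀, ⟨F₀⟩, hX₀, hf₀⟩ := (Q.S 0).exists_cofinite_over (hfg 0) (hell 0)
  obtain ⟨m, X, F, hX, hf, hdeg, hquot⟩ := Q.exists_quot_acyclic X₀ F₀ hX₀ hf₀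
  have hL : ∀ g, g ∈ L ↔ ∃ n, m ≤ n ∧ g ∈ Q.K n := by
    intro g
    rw [MonoidHom.mem_ker, toSeqLimit_eq_one_iff φ]
    constructor
    · rintro ⟨n, hn⟩
      exact ⟨max m n, le_max_left _ _, Q.mono (le_max_right _ _) hn⟩
    · rintro ⟨n, -, hn⟩
      exact ⟨n, hn⟩
  -- The stabilizer of an edge `e` of `X / L` maps onto the image in the limit of the stabilizer of
  -- the edge `ε e` of the tree number `m`.
  let ε : X.E → (S m).tree.Dart := fun e => ⟨(F.f (X.bd false e), F.f (X.bd true e)),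
    F.adj_bd (hdeg e) false⟩
  have hε : ∀ e g, τ m g ∈ (S m).edgeStabilizer (ε e) ↔ g • e = e := fun e g =>
    ⟨fun h => F.stab e (F.adj_bd (hdeg e) false) g h.1 h.2,
      fun h => ⟨F.act_of_smul_eq h false, F.act_of_smul_eq h true⟩⟩
  have hstab : ∀ e g, Φ 0 g ∈ ((S m).edgeStabilizer (ε e)).map (Φ m) ↔
      g • GGraph.kMk L e = GGraph.kMk L e := by
    intro e g
    rw [GGraph.smul_kMk_eq_iff]
    constructor
    · rintro ⟨y, hy, hyg⟩
      obtain ⟨h, rfl⟩ := hτ m y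
      refine ⟨h * g⁻¹, ?_, ?_⟩
      · rw [hΦτ] at hyg
        rw [MonoidHom.mem_ker, map_mul, map_inv, hyg, mul_inv_cancel]
      · rw [inv_mul_cancel_right]
        exact (hε e h).1 hy
    · rintro ⟨k, hk, hke⟩
      refine ⟨τ m (k * g), (hε e _).2 hke, ?_⟩
      rw [hΦτ, map_mul, (MonoidHom.mem_ker).1 hk, one_mul]
  have hH : ∀ n i, (H 0 i).map (τ n) = H n i := by
    intro n i
    induction n with
    | zero =>
      change (H 0 i).map (transition φ 0 0 le_rfl) = _
      rw [transition_self, Subgroup.map_id]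
    | succ n ih =>
      change (H 0 i).map (transition φ 0 (n + 1) (Nat.zero_le _)) = _
      rw [transition_succ φ 0 n (Nat.zero_le n), ← Subgroup.map_map, ← hmap, ← ih]
  have hac : (X.quot L).Acyclic := GGraph.acyclic_quot_iUnion hX hL fun n hn => (hquot n hn).1
  have hnt : ¬ (X.quot L).Elliptic ⊤ := by
    refine Q.not_elliptic_top (fun n => ?_) F hX (fun n hn => (hquot n hn).2) hL hac (hfg 0)
      (hell 0) fun e i => ?_
    · rintro ⟨a, ha⟩
      refine hnontriv n ⟨a, fun g _ => ?_⟩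
      obtain ⟨g, rfl⟩ := hτ n g
      exact ha g trivial
    · by_contra! hcon
      refine hedge m (ε e) i ?_
      rintro _ ⟨y, hy, rfl⟩
      rw [SetLike.mem_coe, ← hH m i] at hy
      obtain ⟨h, hh, rfl⟩ := hy
      have h1 := (hstab e h).2 (hcon h hh)
      rwa [← hΦτ m] at h1
  obtain ⟨Y, hY, hYa, hYnt, ⟨e₀, he₀⟩, hYst, hYell, hYtriv⟩ :=
    GGraph.exists_transitive (hX.quot L) hac (hf.quot L) hnt
  have hsmall := GGraph.small_vertices hY he₀
  have hker : ∀ g, Φ 0 g = 1 → ∀ y : Y.V, g • y = y := by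
    refine fun g hg => hYtriv g fun x => ?_
    obtain ⟨x, rfl⟩ := GGraph.kMk_surjective L x
    exact (GGraph.smul_kMk_eq_iff L).2 ⟨g⁻¹, L.inv_mem hg, by rw [inv_mul_cancel, one_smul]⟩
  obtain ⟨W, T, ι, hadj, hact⟩ := (Y.toTreeAction hY hYa).exists_descend hΦ hker
  replace hact : ∀ g y, T.act (Φ 0 g) (ι y) = ι (g • y) := hact
  have hTell : ∀ (k : ℕ) (K : Subgroup (G k)), (S k).IsElliptic K →
      T.IsElliptic (K.map (Φ k)) := by
    rintro k K ⟨a, ha⟩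
    have h1 : (Q.S k).IsElliptic (K.comap (τ k)) := ⟨a, fun g hg => ha _ hg⟩
    have h2 := (hquot (max k m) (le_max_right _ _)).2 _ (Q.isElliptic_mono (le_max_left k m) h1)
    have hle : Q.K (max k m) ≤ L := fun g hg => (hL g).2 ⟨_, le_max_right _ _, hg⟩
    obtain ⟨y, hy⟩ := hYell _ (GGraph.elliptic_quot_mono hle h2)
    refine ⟨ι y, ?_⟩
    rintro _ ⟨x, hx, rfl⟩
    obtain ⟨g, rfl⟩ := hτ k x
    rw [hΦτ, hact, hy g hx]
  refine ⟨W, T, ?_, fun k i => hTell k _ (hell k i), ?_, hTell⟩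
  · rintro ⟨w, hw⟩
    obtain ⟨y, rfl⟩ := ι.surjective w
    refine hYnt ⟨y, fun g _ => ι.injective ?_⟩
    rw [← hact]
    exact hw _ trivial
  · obtain ⟨e', he'⟩ := hYst e₀
    obtain ⟨e', rfl⟩ := GGraph.kMk_surjective L e'
    refine ⟨m, ε e', ⟨(ι (Y.bd false e₀), ι (Y.bd true e₀)), (hadj _ _).2 ⟨false, e₀, rfl, rfl⟩⟩,
      ?_, ?_⟩
    · ext c
      obtain ⟨g, rfl⟩ := hΦ c
      refine Iff.trans ?_ ((he' g).trans (hstab e' g).symm)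
      change T.act (Φ 0 g) (ι _) = ι _ ∧ T.act (Φ 0 g) (ι _) = ι _ ↔ _
      rw [hact, hact, ι.apply_eq_iff_eq, ι.apply_eq_iff_eq, ← Y.bd_smul, ← Y.bd_smul]
      exact ⟨fun h => hYa.eq_of_bd_eq (i := false) (j := false) h.1 h.2,
        fun h => by rw [h]; exact ⟨rfl, rfl⟩⟩
    · rintro ⟨⟨a, b⟩, hab⟩
      obtain ⟨a, rfl⟩ := ι.surjective a
      obtain ⟨b, rfl⟩ := ι.surjective b
      obtain ⟨i, e, rfl, rfl⟩ := (hadj a b).1 hab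
      obtain ⟨g, rfl⟩ := he₀ e
      refine ⟨Φ 0 g, ?_⟩
      have hg : ∀ j, T.act (Φ 0 g) (ι (Y.bd j e₀)) = ι (Y.bd j (g • e₀)) :=
        fun j => (hact g _).trans (congrArg ι (Y.bd_smul j g e₀).symm)
      cases i
      · exact Or.inl ⟨hg false, hg true⟩
      · exact Or.inr ⟨hg false, hg true⟩
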